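/- All graphs are finite and simple, and $\rho(G)$ denotes the largest eigenvalue of the adjacency matrix of $G$. A graph is $F$-free if it contains no (not necessarily induced) subgraph isomorphic to $F$. Let $\mathrm{spex}(n,F)$ be the maximum of $\rho(G)$ over all $F$-free graphs $G$ of order $n$, and let $\mathrm{SPEX}(n,F)$ be the set of $F$-free graphs $G$ of order $n$ with $\rho(G)=\mathrm{spex}(n,F)$, considered up to isomorphism. For $n>k>0$ and $0\le p\le\lfloor (n-k)/2\rfloor$, let $S_{n,k}^{p}$ be the graph obtained from the join of the complete graph $K_k$ with $n-k$ isolated vertices by adding $p$ pairwise disjoint edges among these $n-k$ vertices. A spider is a tree of order at least $4$ with at most one vertex of degree at least $3$. Its center is the vertex of degree at least $3$; if there is none, the spider is a path and any vertex of degree $2$ may be taken as its center. A leg is a path from the center to a leaf, and its length is its number of edges. Theorem. Let $r_1,r_2,r_3,r,s,\ell$ be non-negative integers with $r=r_1+r_2+r_3$ and $\ell\ge 4$, and let $F$ be a spider of order $\ell$ which, with respect to a chosen center, has $r_1$ legs of odd length at least $5$, $r_2$ legs of length $3$, $r_3$ legs of length $1$ and $s$ legs of even length. Then, for all sufficiently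 large $n$ (depending on $F$), $$\mathrm{SPEX}(n,F)=\begin{cases} \{S_{n,(\ell-r-1)/2}^{0}\} & \text{if } s\ge 1 \text{ and } r\ge 1,\\ \{S_{n,(\ell-3)/2}^{1}\} & \text{if } s\ge 1 \text{ and } r=0,\\ \{S_{n,(\ell-r-1)/2}^{1}\} & \text{if } s=0 \text{ and } r_1\ge 1,\\ \{S_{n,(\ell-r-1)/2}^{r-1}\} & \text{if } s=0,\ r_1=0,\ r_2\ge 1 \text{ and } r_3\in\{0,1\},\\ \{S_{n,(\ell-r-1)/2}^{\lfloor (2n-\ell+r+1)/4\rfloor}\} & \text{if } s=0,\ r_1=0,\ r_2\ge 1 \text{ and } r_3\ge 2. \end{cases}$$ (The remaining case $s=r_1=r_2=0$, in which $F$ is a star, is not covered.) -/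

import Mathlib

namespace SpectralSpider

/-- The spectral radius `ρ(G)` of a finite graph: the largest eigenvalue of its adjacency matrix.
The spectrum is a finite set, nonempty as soon as `G` has a vertex, so the supremum is a maximum. -/
noncomputable def specRadius {V : Type*} [Fintype V] (G : SimpleGraph V) : ℝ :=
  open Classical in sSup (spectrum ℝ (G.adjMatrix ℝ))

/-- `spex(n, F)`: the maximum spectral radius of an `F`-free graph of order `n`
(a supremum over a finite set of reals). -/
noncomputable def spex {V : Type*} (n : ℕ) (F : SimpleGraph V) : ℝ :=
  sSup {x : ℝ | ∃ G : SimpleGraph (Fin n), F.Free G ∧ specRadius G = x}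

/-- `SPEX(n, F)`: the (labelled) `F`-free graphs of order `n` whose spectral radius is
`spex(n, F)`. -/
def SPEX {V : Type*} (n : ℕ) (F : SimpleGraph V) : Set (SimpleGraph (Fin n)) :=
  {G | F.Free G ∧ specRadius G = spex n F}

/-- The graph `S_{n,k}^p`: the vertices `0, …, k-1` are adjacent to all other vertices, and among
the remaining `n - k` vertices the only edges are the `p` independent edges
`{k + 2i, k + 2i + 1}`, `i < p` (meant for `0 < k < n` and `p ≤ ⌊(n - k) / 2⌋`). -/
def graphS (n k p : ℕ) : SimpleGraph (Fin n) :=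
  SimpleGraph.fromRel fun u v : Fin n =>
    (u : ℕ) < k ∨ ∃ i < p, (u : ℕ) = k + 2 * i ∧ (v : ℕ) = k + 2 * i + 1

/-- The set `{S_{n,k}^p}`, graphs being considered up to isomorphism. -/
def isoClassS (n k p : ℕ) : Set (SimpleGraph (Fin n)) :=
  {G | Nonempty (G ≃g graphS n k p)}

/-- A spider: a tree of order at least 4 with at most one vertex of degree at least 3. -/
def IsSpider {V : Type*} [Fintype V] (F : SimpleGraph V) [DecidableRel F.Adj] : Prop :=
  F.IsTree ∧ 4 ≤ Fintype.card V ∧ {v : V | 3 ≤ F.degree v}.Subsingleton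

/-- `c` is a center of the spider `F`: the vertex of degree at least 3 or, if all degrees are at
most 2 (so that `F` is a path), any vertex of degree 2. -/
def IsCenter {V : Type*} [Fintype V] (F : SimpleGraph V) [DecidableRel F.Adj] (c : V) : Prop :=
  3 ≤ F.degree c ∨ (F.degree c = 2 ∧ ∀ v, F.degree v ≤ 2)

/-- The number of legs of `F` with center `c` whose length satisfies `P`. A leg is a path from `c`
to a leaf; in a tree such a path is determined by the leaf, so the leaves are counted. -/
noncomputable def legCount {V : Type*} [Fintype V] (F : SimpleGraph V) [DecidableRel F.Adj]
    (c : V) (P : ℕ → Prop) : ℕ :=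
  {v : V | F.degree v = 1 ∧ ∃ p : F.Walk c v, p.IsPath ∧ P p.length}.ncard

end SpectralSpider

namespace SpectralSpider

open Finset

/-! Let `m i` be the leg lengths, and let `k` be `∑ i, m i / 2`, lowered by one when all legs are
even. Then `F` has an independent vertex cover of size `k + 1`, while `S_{n,k}^p` is `F`-free for
the claimed `p`. An extremal graph `G` therefore contains no `K_{k+1,ℓ}` and satisfies `ρ² ≥ k (n -
k)`. It is also sparse, since a forest embeds greedily into any graph of large minimum degree.

Take a nonnegative eigenvector `x` for `ρ` with maximum one. Counting walks of length two yields a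
set `S` of `k` vertices whose weight is close to one and which are adjacent to almost everything,
all other vertices being light (`PerronData.exists_heavy_common`). If a vertex outside `S` missed
one of them, trading all its edges for the edges to `S` would keep the graph `F`-free
(`free_rejoin`) and not lower the Rayleigh quotient, and the equality case is impossible
(`PerronData.exists_dominating`). So `S` is joined to everything outside it.

The rest concerns `F` alone: which edges may remain after deleting at most `k` independent vertices
(`Splits`)? A path on three vertices may remain, so the edges of `G` outside `S` form a matching.
Unless `p` is already the largest size that fits, `p + 1` disjoint edges may remain as well, so this
matching has at most `p` edges. Thus `G` lies in a copy of `S_{n,k}^p`, and strict monotonicity of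
`ρ` gives equality (`SPEX_eq_isoClassS`).

The five cases differ only in which matchings can remain. Explicit deletions along the legs give the
upper bounds on `p`. Freeness of `S_{n,k}^p` comes from systems of disjoint edges along the legs,
nearly all of which must be hit by the deleted set. -/

/-- The entries of the adjacency matrix, as real numbers. -/
noncomputable def adjInd {α : Type*} (G : SimpleGraph α) (u v : α) : ℝ :=
  open Classical in if G.Adj u v then 1 else 0

section AdjInd

variable {α : Type*} (G : SimpleGraph α)

lemma adjInd_of_adj {G : SimpleGraph α} {u v : α} (h : G.Adj u v) : adjInd G u v = 1 := by
  simp [adjInd, h]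

lemma adjInd_of_not_adj {G : SimpleGraph α} {u v : α} (h : ¬ G.Adj u v) : adjInd G u v = 0 := by
  simp [adjInd, h]

lemma adjInd_nonneg (u v : α) : 0 ≤ adjInd G u v := by
  unfold adjInd; split_ifs <;> norm_num

lemma adjInd_le_one (u v : α) : adjInd G u v ≤ 1 := by
  unfold adjInd; split_ifs <;> norm_num

lemma adjInd_comm (u v : α) : adjInd G u v = adjInd G v u := by
  by_cases h : G.Adj u v
  · rw [adjInd_of_adj h, adjInd_of_adj h.symm]
  · rw [adjInd_of_not_adj h, adjInd_of_not_adj fun h' => h h'.symm]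

lemma adjInd_mono {G H : SimpleGraph α} (h : G ≤ H) (u v : α) : adjInd G u v ≤ adjInd H u v := by
  by_cases huv : G.Adj u v
  · rw [adjInd_of_adj huv, adjInd_of_adj (h huv)]
  · rw [adjInd_of_not_adj huv]; exact adjInd_nonneg _ _ _

end AdjInd

/-! ### Rayleigh quotients and Perron vectors. -/

section SpecRadius

variable {α : Type*} [Fintype α]

/-- The quadratic form of the adjacency matrix. -/
noncomputable def quadForm (G : SimpleGraph α) (y : α → ℝ) : ℝ :=
  ∑ v, y v * ∑ u, adjInd G v u * y u

open Classical in
lemma adjMatrix_mulVec_eq (G : SimpleGraph α) (y : α → ℝ) (v : α) :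
    (G.adjMatrix ℝ).mulVec y v = ∑ u, adjInd G v u * y u := by
  simp [Matrix.mulVec, dotProduct, adjInd, SimpleGraph.adjMatrix_apply]

open Classical in
omit [Fintype α] in
lemma adjMatrix_isHermitian (G : SimpleGraph α) : (G.adjMatrix ℝ).IsHermitian := by
  ext i j
  simp [SimpleGraph.adjMatrix_apply, G.adj_comm]

open Classical in
lemma specRadius_eq (G : SimpleGraph α) :
    specRadius G = sSup (Set.range (adjMatrix_isHermitian G).eigenvalues) := by
  unfold specRadius
  rw [(adjMatrix_isHermitian G).spectrum_real_eq_range_eigenvalues]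

-- The spectrum of `ρ I - A` consists of the differences `ρ - μ` with `μ` an eigenvalue of `A`.
-- Semidefiniteness yields both Rayleigh's inequality and its equality case.
open Classical in
lemma posSemidef_specRadius_sub (G : SimpleGraph α) :
    (specRadius G • (1 : Matrix α α ℝ) - G.adjMatrix ℝ).PosSemidef := by
  rw [Matrix.posSemidef_iff_isHermitian_and_spectrum_nonneg]
  refine ⟨?_, ?_⟩
  · refine Matrix.IsHermitian.sub ?_ (adjMatrix_isHermitian G)
    simp [Matrix.IsHermitian]
  · intro x hx
    have h1 : specRadius G - x ∈ spectrum ℝ (G.adjMatrix ℝ) := by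
      have h2 := spectrum.singleton_sub_eq (G.adjMatrix ℝ) (specRadius G)
      rw [Algebra.algebraMap_eq_smul_one] at h2
      rw [← h2] at hx
      obtain ⟨a, ha, b, hb, rfl⟩ := Set.mem_sub.1 hx
      rw [Set.mem_singleton_iff] at ha
      subst ha
      simpa using hb
    have h2 : specRadius G - x ≤ specRadius G := by
      have hfin : (Set.range (adjMatrix_isHermitian G).eigenvalues).Finite := Set.finite_range _
      rw [(adjMatrix_isHermitian G).spectrum_real_eq_range_eigenvalues] at h1
      have := le_csSup hfin.bddAbove h1
      rwa [← specRadius_eq] at this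
    show (0:ℝ) ≤ x
    linarith

open Classical in
lemma quadForm_sub (G : SimpleGraph α) (y : α → ℝ) :
    dotProduct (star y) ((specRadius G • (1 : Matrix α α ℝ) - G.adjMatrix ℝ).mulVec y)
      = specRadius G * ∑ v, y v ^ 2 - quadForm G y := by
  simp only [dotProduct, Matrix.sub_mulVec, Pi.sub_apply, adjMatrix_mulVec_eq, quadForm,
    mul_sub, sum_sub_distrib, mul_sum, Matrix.smul_mulVec, Matrix.one_mulVec, Pi.smul_apply,
    smul_eq_mul, star_trivial]
  congr 1
  exact sum_congr rfl fun v _ => by ring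

/-- Rayleigh's inequality. -/
lemma quadForm_le (G : SimpleGraph α) (y : α → ℝ) :
    quadForm G y ≤ specRadius G * ∑ v, y v ^ 2 := by
  classical
  have h := (posSemidef_specRadius_sub G).dotProduct_mulVec_nonneg y
  rw [quadForm_sub] at h
  linarith

/-- Equality in Rayleigh's inequality holds only for eigenvectors. -/
lemma eigen_of_quadForm_eq (G : SimpleGraph α) (y : α → ℝ)
    (h : specRadius G * ∑ v, y v ^ 2 ≤ quadForm G y) (v : α) :
    ∑ u, adjInd G v u * y u = specRadius G * y v := by
  classical
  have h0 : dotProduct (star y)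
      ((specRadius G • (1 : Matrix α α ℝ) - G.adjMatrix ℝ).mulVec y) = 0 := by
    rw [quadForm_sub]; linarith [quadForm_le G y]
  rw [(posSemidef_specRadius_sub G).dotProduct_mulVec_zero_iff] at h0
  have h1 := congrFun h0 v
  rw [Matrix.sub_mulVec, Pi.sub_apply, adjMatrix_mulVec_eq, Matrix.smul_mulVec,
    Matrix.one_mulVec] at h1
  simp only [Pi.smul_apply, smul_eq_mul, Pi.zero_apply] at h1
  linarith

/-- A nonnegative eigenvector for the spectral radius, normalised to have maximum one. -/
lemma exists_perron_vector [Nonempty α] (G : SimpleGraph α) :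
    ∃ x : α → ℝ, (∀ v, 0 ≤ x v) ∧ (∀ v, x v ≤ 1) ∧ (∃ z, x z = 1) ∧
      ∀ v, ∑ u, adjInd G v u * x u = specRadius G * x v := by
  classical
  have hmem : specRadius G ∈ Set.range (adjMatrix_isHermitian G).eigenvalues := by
    rw [specRadius_eq]
    exact (Set.range_nonempty _).csSup_mem (Set.finite_range _)
  obtain ⟨i, hi⟩ := hmem
  set y : α → ℝ := ⇑((adjMatrix_isHermitian G).eigenvectorBasis i) with hy
  have hy0 : y ≠ 0 := by
    intro h0
    have := (adjMatrix_isHermitian G).eigenvectorBasis.toBasis.ne_zero i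
    apply this
    ext v
    simpa using congrFun h0 v
  have hyA : ∀ v, ∑ u, adjInd G v u * y u = specRadius G * y v := by
    intro v
    have := congrFun ((adjMatrix_isHermitian G).mulVec_eigenvectorBasis i) v
    rw [adjMatrix_mulVec_eq, hi] at this
    simpa using this
  -- Taking absolute values keeps the norm and cannot lower the quadratic form, so `|y|` also
  -- attains equality in Rayleigh's inequality and is an eigenvector.
  have habs : specRadius G * ∑ v, |y v| ^ 2 ≤ quadForm G (fun v => |y v|) := by
    have e1 : specRadius G * ∑ v, |y v| ^ 2 = quadForm G y := by
      unfold quadForm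
      simp only [hyA, sq_abs, mul_sum]
      exact sum_congr rfl fun v _ => by ring
    rw [e1]
    unfold quadForm
    simp only [mul_sum]
    refine sum_le_sum fun v _ => sum_le_sum fun u _ => ?_
    calc y v * (adjInd G v u * y u) ≤ |y v * (adjInd G v u * y u)| := le_abs_self _
      _ = |y v| * (adjInd G v u * |y u|) := by
        rw [abs_mul, abs_mul, abs_of_nonneg (adjInd_nonneg G v u)]
  have heig := eigen_of_quadForm_eq G _ habs
  obtain ⟨z, -, hz⟩ := exists_max_image univ (fun v => |y v|) univ_nonempty
  have hzpos : 0 < |y z| := by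
    by_contra hcon
    apply hy0
    funext v
    have h1 := hz v (mem_univ v)
    have h2 := abs_nonneg (y v)
    exact abs_eq_zero.1 (by linarith [not_lt.1 hcon])
  refine ⟨fun v => |y v| / |y z|, fun v => by positivity, fun v => ?_, ⟨z, div_self hzpos.ne'⟩,
    fun v => ?_⟩
  · rw [div_le_one hzpos]; exact hz v (mem_univ v)
  · simp only [← mul_div_assoc, ← sum_div, heig]

lemma specRadius_congr {β : Type*} [Fintype β] {G : SimpleGraph α} {H : SimpleGraph β}
    (e : G ≃g H) : specRadius G = specRadius H := by
  classical
  unfold specRadius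
  congr 1
  have : G.adjMatrix ℝ = Matrix.reindexAlgEquiv ℝ ℝ e.toEquiv.symm (H.adjMatrix ℝ) := by
    ext i j
    have h := e.map_adj_iff (v := i) (w := j)
    by_cases hij : G.Adj i j
    · simp [SimpleGraph.adjMatrix_apply, hij, h.2 hij]
    · have h' : ¬ H.Adj (e i) (e j) := fun h' => hij (h.1 h')
      simpa [SimpleGraph.adjMatrix_apply, hij] using h'
  rw [this, AlgEquiv.spectrum_eq]

end SpecRadius

/-! ### Embedding forests, sparsity, and rejoining a vertex. -/

section Embedding

lemma exists_injOn_mapsTo {V α : Type*} [Nonempty α] (s : Finset V) (t : Finset α)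
    (h : #s ≤ #t) : ∃ f : V → α, (∀ v ∈ s, f v ∈ t) ∧ Set.InjOn f s := by
  classical
  obtain ⟨e⟩ := Function.Embedding.nonempty_of_card_le (α := s) (β := t) (by simpa using h)
  refine ⟨fun v => if h : v ∈ s then (e ⟨v, h⟩ : α) else Classical.arbitrary α, ?_, ?_⟩
  · intro v hv
    simp [hv]
  · intro v hv w hw hvw
    have hv' : v ∈ s := hv
    have hw' : w ∈ s := hw
    simp only [hv', hw', dif_pos] at hvw
    simpa using e.injective (Subtype.ext hvw)

/-- If `S` is complete to the large set `B`, then `F` embeds as soon as an independent set `T` of at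
most `#S` vertices can be removed so that all remaining edges lie in `W`, which embeds in `B`. -/
lemma isContained_of_split {V α : Type*} [Fintype V] (F : SimpleGraph V) (G : SimpleGraph α)
    (S B : Finset α) (hSB : ∀ s ∈ S, ∀ b ∈ B, G.Adj s b) (T W : Finset V) (f₀ : V → α)
    (hT : #T ≤ #S) (hB : Fintype.card V ≤ #B)
    (hW : ∀ v ∈ W, f₀ v ∈ B) (hinj : Set.InjOn f₀ W)
    (hTind : ∀ u ∈ T, ∀ v ∈ T, ¬ F.Adj u v)
    (hrest : ∀ u v, u ∉ T → v ∉ T → F.Adj u v → u ∈ W ∧ v ∈ W ∧ G.Adj (f₀ u) (f₀ v)) :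
    F.IsContained G := by
  classical
  rcases isEmpty_or_nonempty V with hV | ⟨⟨v₀⟩⟩
  · exact SimpleGraph.IsContained.of_isEmpty
  have hα : Nonempty α := ⟨f₀ v₀⟩
  obtain ⟨f₁, h₁, i₁⟩ := exists_injOn_mapsTo T S hT
  -- Vertices outside `T ∪ W` are isolated once `T` is removed, so any unused vertices of `B` will
  -- do for them.
  have hcard : #((T ∪ W)ᶜ) ≤ #(B \ W.image f₀) := by
    have e1 : #(W.image f₀) ≤ #W := card_image_le
    have e2 := le_card_sdiff (W.image f₀) B
    have e3 := card_le_card (subset_union_right (s₁ := T) (s₂ := W))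
    rw [card_compl]
    omega
  obtain ⟨f₂, h₂, i₂⟩ := exists_injOn_mapsTo (T ∪ W)ᶜ (B \ W.image f₀) hcard
  set f : V → α := fun v => if v ∈ T then f₁ v else if v ∈ W then f₀ v else f₂ v with hf
  have fT : ∀ v ∈ T, f v = f₁ v := fun v hv => by simp [hf, hv]
  have fW : ∀ v, v ∉ T → v ∈ W → f v = f₀ v := fun v hv hv' => by simp [hf, hv, hv']
  have fQ : ∀ v, v ∉ T → v ∉ W → f v = f₂ v := fun v hv hv' => by simp [hf, hv, hv']
  have hQ : ∀ v, v ∉ T → v ∉ W → f₂ v ∈ B ∧ ∀ w ∈ W, f₀ w ≠ f₂ v := fun v hv hv' => by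
    have := h₂ v (by simp [hv, hv'])
    simpa using this
  have hfB : ∀ v, v ∉ T → f v ∈ B := by
    intro v hv
    by_cases hvW : v ∈ W
    · rw [fW v hv hvW]; exact hW v hvW
    · rw [fQ v hv hvW]; exact (hQ v hv hvW).1
  have hfS : ∀ v ∈ T, f v ∈ S := fun v hv => by rw [fT v hv]; exact h₁ v hv
  have hdisj : ∀ s ∈ S, ∀ b ∈ B, s ≠ b := fun s hs b hb => (hSB s hs b hb).ne
  refine ⟨⟨⟨f, ?_⟩, ?_⟩⟩
  · intro u v huv
    by_cases hu : u ∈ T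
    · by_cases hv : v ∈ T
      · exact absurd huv (hTind u hu v hv)
      · exact hSB _ (hfS u hu) _ (hfB v hv)
    · by_cases hv : v ∈ T
      · exact (hSB _ (hfS v hv) _ (hfB u hu)).symm
      · obtain ⟨a, b, c⟩ := hrest u v hu hv huv
        rw [fW u hu a, fW v hv b]
        exact c
  · intro u v huv
    change f u = f v at huv
    by_cases hu : u ∈ T
    · by_cases hv : v ∈ T
      · rw [fT u hu, fT v hv] at huv
        exact i₁ hu hv huv
      · exact absurd huv (hdisj _ (hfS u hu) _ (hfB v hv))
    · by_cases hv : v ∈ T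
      · exact absurd huv.symm (hdisj _ (hfS v hv) _ (hfB u hu))
      · by_cases hu' : u ∈ W
        · by_cases hv' : v ∈ W
          · rw [fW u hu hu', fW v hv hv'] at huv
            exact hinj hu' hv' huv
          · rw [fW u hu hu', fQ v hv hv'] at huv
            exact absurd huv ((hQ v hv hv').2 u hu')
        · by_cases hv' : v ∈ W
          · rw [fQ u hu hu', fW v hv hv'] at huv
            exact absurd huv.symm ((hQ u hu hu').2 v hv')
          · rw [fQ u hu hu', fQ v hv hv'] at huv
            exact i₂ (by simp [hu, hu']) (by simp [hv, hv']) huv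

open Classical in
/-- Greedy embedding of a rooted forest into a graph of large minimum degree. -/
lemma isContained_of_minDegree {V α : Type*} [Fintype V] (F : SimpleGraph V) (d : V → ℕ)
    (par : V → V)
    (hpar : ∀ u v, F.Adj u v → (u = par v ∧ d u < d v) ∨ (v = par u ∧ d v < d u))
    (G : SimpleGraph α) (W : Finset α) (hW : W.Nonempty)
    (h : ∀ w ∈ W, Fintype.card V ≤ #{u ∈ W | G.Adj w u}) : F.IsContained G := by
  obtain ⟨w₀, hw₀⟩ := hW
  have key : ∀ s : Finset V, ∃ f : V → α, Set.InjOn f s ∧ (∀ v ∈ s, f v ∈ W) ∧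
      ∀ u ∈ s, ∀ v ∈ s, F.Adj u v → G.Adj (f u) (f v) := by
    intro s
    -- Vertices are placed in order of depth, so the only placed vertex that can be adjacent to the
    -- new one is its parent.
    induction s using Finset.induction_on_max_value d with
    | empty => exact ⟨fun _ => w₀, by simp⟩
    | insert a s ha hmax ih =>
      obtain ⟨f, hinj, hfW, hadj⟩ := ih
      have hnew : ∃ b ∈ W, b ∉ s.image f ∧ (par a ∈ s → G.Adj (f (par a)) b) := by
        have hs : #(s.image f) < Fintype.card V := by
          refine lt_of_le_of_lt card_image_le ?_
          have := card_le_univ (insert a s)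
          rw [card_insert_of_notMem ha] at this
          omega
        have hex : ∀ w ∈ W, ∃ b ∈ W, b ∉ s.image f ∧ G.Adj w b := by
          intro w hw
          obtain ⟨b, hb, hb'⟩ := exists_mem_notMem_of_card_lt_card (hs.trans_le (h w hw))
          rw [mem_filter] at hb
          exact ⟨b, hb.1, hb', hb.2⟩
        by_cases hp : par a ∈ s
        · obtain ⟨b, hb, hb', hb''⟩ := hex _ (hfW _ hp)
          exact ⟨b, hb, hb', fun _ => hb''⟩
        · obtain ⟨b, hb, hb', -⟩ := hex _ hw₀
          exact ⟨b, hb, hb', fun h' => absurd h' hp⟩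
      obtain ⟨b, hbW, hbs, hbadj⟩ := hnew
      have hne : ∀ v ∈ s, v ≠ a := fun v hv h' => ha (h' ▸ hv)
      have hf : ∀ v ∈ s, Function.update f a b v = f v := fun v hv => by
        rw [Function.update_of_ne (hne v hv)]
      have hpa : ∀ u ∈ s, F.Adj u a → G.Adj (f u) b := by
        intro u hu hua
        rcases hpar u a hua with ⟨h1, -⟩ | ⟨-, h1⟩
        · subst h1; exact hbadj hu
        · exact absurd (hmax u hu) (not_le.2 h1)
      have hbne : ∀ v ∈ s, f v ≠ b := fun v hv h' => hbs (mem_image.2 ⟨v, hv, h'⟩)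
      refine ⟨Function.update f a b, ?_, ?_, ?_⟩
      · intro u hu v hv huv
        rw [mem_coe, mem_insert] at hu hv
        rcases hu with rfl | hu <;> rcases hv with rfl | hv
        · rfl
        · rw [hf v hv, Function.update_self] at huv
          exact absurd huv.symm (hbne v hv)
        · rw [hf u hu, Function.update_self] at huv
          exact absurd huv (hbne u hu)
        · rw [hf u hu, hf v hv] at huv
          exact hinj hu hv huv
      · intro v hv
        rcases mem_insert.1 hv with rfl | hv
        · rwa [Function.update_self]
        · rw [hf v hv]; exact hfW v hv
      · intro u hu v hv huv
        rcases mem_insert.1 hu with rfl | hu' <;> rcases mem_insert.1 hv with rfl | hv'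
        · exact absurd huv (F.irrefl)
        · rw [hf v hv', Function.update_self]
          exact (hpa v hv' huv.symm).symm
        · rw [hf u hu', Function.update_self]
          exact hpa u hu' huv
        · rw [hf u hu', hf v hv']
          exact hadj u hu' v hv' huv
  obtain ⟨f, hinj, -, hadj⟩ := key univ
  refine ⟨⟨⟨f, fun {u v} huv => hadj u (mem_univ u) v (mem_univ v) huv⟩, ?_⟩⟩
  intro u v huv
  exact hinj (by simp) (by simp) huv

/-- Every vertex set `W` spans at most `ℓ * #W` edges (counted twice). -/
def IsSparse {α : Type*} (ℓ : ℕ) (G : SimpleGraph α) : Prop :=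
  ∀ W : Finset α, ∑ u ∈ W, ∑ v ∈ W, adjInd G u v ≤ 2 * ℓ * #W

lemma sum_adjInd_eq_card {α : Type*} (G : SimpleGraph α) (W : Finset α) (u : α)
    [DecidablePred (G.Adj u)] : ∑ v ∈ W, adjInd G u v = #{v ∈ W | G.Adj u v} := by
  rw [card_filter]
  push_cast
  refine sum_congr rfl fun v _ => ?_
  by_cases h : G.Adj u v
  · rw [adjInd_of_adj h, if_pos h]
  · rw [adjInd_of_not_adj h, if_neg h]

-- Removing a vertex of degree less than `ℓ` inside `W` costs at most `ℓ` edges, each counted twice.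
open Classical in
lemma isSparse_of_degenerate {α : Type*} (ℓ : ℕ) (G : SimpleGraph α)
    (h : ∀ W : Finset α, W.Nonempty → ∃ w ∈ W, #{u ∈ W | G.Adj w u} < ℓ) : IsSparse ℓ G := by
  intro W
  induction W using Finset.strongInduction with
  | H W ih =>
    rcases W.eq_empty_or_nonempty with rfl | hW
    · simp
    obtain ⟨w, hw, hlt⟩ := h W hW
    have ih' := ih (W.erase w) (erase_ssubset hw)
    rw [← insert_erase hw, card_insert_of_notMem (notMem_erase w W)]
    have e0 : ∑ v ∈ W.erase w, adjInd G w v ≤ ℓ := by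
      calc ∑ v ∈ W.erase w, adjInd G w v ≤ ∑ v ∈ W, adjInd G w v :=
            sum_le_sum_of_subset_of_nonneg (erase_subset _ _) fun v _ _ => adjInd_nonneg G w v
        _ ≤ ℓ := by rw [sum_adjInd_eq_card]; exact_mod_cast hlt.le
    have e1 : ∑ u ∈ W.erase w, adjInd G u w = ∑ v ∈ W.erase w, adjInd G w v :=
      sum_congr rfl fun v _ => adjInd_comm G v w
    rw [sum_insert (notMem_erase w W), sum_insert (notMem_erase w W)]
    simp only [sum_insert (notMem_erase w W)]
    rw [sum_add_distrib, e1, adjInd_of_not_adj (G.irrefl)]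
    push_cast
    linarith

lemma IsSparse.sum_le {α : Type*} {ℓ : ℕ} {G : SimpleGraph α} (h : IsSparse ℓ G)
    (P Q : Finset α) : ∑ u ∈ P, ∑ v ∈ Q, adjInd G u v ≤ 2 * ℓ * (#P + #Q) := by
  classical
  have hc : (#(P ∪ Q) : ℝ) ≤ #P + #Q := by exact_mod_cast card_union_le P Q
  calc ∑ u ∈ P, ∑ v ∈ Q, adjInd G u v ≤ ∑ u ∈ P ∪ Q, ∑ v ∈ Q, adjInd G u v :=
        sum_le_sum_of_subset_of_nonneg subset_union_left
          fun u _ _ => sum_nonneg fun v _ => adjInd_nonneg G u v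
    _ ≤ ∑ u ∈ P ∪ Q, ∑ v ∈ P ∪ Q, adjInd G u v :=
        sum_le_sum fun u _ => sum_le_sum_of_subset_of_nonneg subset_union_right
          fun v _ _ => adjInd_nonneg G u v
    _ ≤ 2 * ℓ * #(P ∪ Q) := h _
    _ ≤ _ := by gcongr

/-- Delete all edges at `v`, then join `v` to the vertices of `S`. -/
def rejoin {α : Type*} (G : SimpleGraph α) (v : α) (S : Finset α) : SimpleGraph α :=
  SimpleGraph.fromRel fun u w => (u ≠ v ∧ w ≠ v ∧ G.Adj u w) ∨ (u = v ∧ w ∈ S)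

lemma rejoin_adj_self {α : Type*} (G : SimpleGraph α) {v : α} {S : Finset α} (hv : v ∉ S)
    (w : α) : (rejoin G v S).Adj v w ↔ w ∈ S := by
  simp only [rejoin, SimpleGraph.fromRel_adj]
  constructor
  · rintro ⟨h0, (⟨h, -, -⟩ | ⟨-, h⟩) | (⟨-, h, -⟩ | ⟨h, -⟩)⟩
    · exact absurd rfl h
    · exact h
    · exact absurd rfl h
    · exact absurd h.symm h0
  · intro h
    exact ⟨fun h' => hv (h' ▸ h), Or.inl (Or.inr ⟨trivial, h⟩)⟩

lemma rejoin_adj_of_ne {α : Type*} (G : SimpleGraph α) {v : α} {S : Finset α} {u w : α}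
    (hu : u ≠ v) (hw : w ≠ v) : (rejoin G v S).Adj u w ↔ G.Adj u w := by
  simp only [rejoin, SimpleGraph.fromRel_adj]
  constructor
  · rintro ⟨h0, (⟨-, -, h⟩ | ⟨h, -⟩) | (⟨-, -, h⟩ | ⟨h, -⟩)⟩
    · exact h
    · exact absurd h hu
    · exact h.symm
    · exact absurd h hw
  · intro h
    exact ⟨h.ne, Or.inl (Or.inl ⟨hu, hw, h⟩)⟩

/-- Rejoining a vertex to a set with many common neighbours creates no new copies. -/
lemma free_rejoin {V α : Type*} [Fintype V] {F : SimpleGraph V} {G : SimpleGraph α}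
    (hG : F.Free G) {v : α} {S B : Finset α} (hv : v ∉ S)
    (hSB : ∀ s ∈ S, ∀ b ∈ B, G.Adj s b) (hB : Fintype.card V ≤ #B) :
    F.Free (rejoin G v S) := by
  classical
  rintro ⟨f⟩
  apply hG
  have hfinj : Function.Injective f := f.injective
  have hfadj : ∀ {a b}, F.Adj a b → (rejoin G v S).Adj (f a) (f b) := fun h => f.toHom.map_adj h
  by_cases hex : ∃ a, f a = v
  · obtain ⟨a, ha⟩ := hex
    -- At `v` the copy of `F` only uses edges to `S`, so a vertex of `B` outside the copy can take
    -- over the role of `v` in `G`.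
    obtain ⟨b, hbB, hb⟩ : ∃ b ∈ B, b ∉ (univ.erase a).image f := by
      apply exists_mem_notMem_of_card_lt_card
      refine lt_of_le_of_lt card_image_le ?_
      rw [card_erase_of_mem (mem_univ a), card_univ]
      have : 0 < Fintype.card V := Fintype.card_pos_iff.2 ⟨a⟩
      omega
    have hb' : ∀ u, u ≠ a → f u ≠ b := fun u hu h' =>
      hb (mem_image.2 ⟨u, by simp [hu], h'⟩)
    have hne : ∀ u, u ≠ a → f u ≠ v := fun u hu h' => hu (hfinj (h'.trans ha.symm))
    have hab : ∀ u, F.Adj a u → G.Adj b (f u) := by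
      intro u hu
      have := hfadj hu
      rw [ha, rejoin_adj_self G hv] at this
      exact (hSB _ this _ hbB).symm
    refine ⟨⟨⟨Function.update f a b, ?_⟩, ?_⟩⟩
    · intro u w huw
      by_cases hu : u = a
      · subst hu
        rw [Function.update_self, Function.update_of_ne huw.ne']
        exact hab w huw
      · by_cases hw : w = a
        · subst hw
          rw [Function.update_self, Function.update_of_ne hu]
          exact (hab u huw.symm).symm
        · rw [Function.update_of_ne hu, Function.update_of_ne hw]
          exact (rejoin_adj_of_ne G (hne u hu) (hne w hw)).1 (hfadj huw)
    · intro u w huw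
      change Function.update f a b u = Function.update f a b w at huw
      by_cases hu : u = a <;> by_cases hw : w = a
      · rw [hu, hw]
      · rw [hu, Function.update_self, Function.update_of_ne hw] at huw
        exact absurd huw.symm (hb' w hw)
      · rw [hw, Function.update_self, Function.update_of_ne hu] at huw
        exact absurd huw (hb' u hu)
      · rw [Function.update_of_ne hu, Function.update_of_ne hw] at huw
        exact hfinj huw
  · push Not at hex
    exact ⟨⟨⟨f, fun {u w} huw => (rejoin_adj_of_ne G (hex u) (hex w)).1 (hfadj huw)⟩, hfinj⟩⟩

end Embedding

/-! ### Heavy vertices of a sparse graph with large spectral radius. -/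

/-- A sparse graph without complete bipartite subgraphs `K_{k+1,ℓ}`, together with a normalised
nonnegative eigenvector for an eigenvalue `lam ≥ √(k (n - k))`. -/
structure PerronData {α : Type*} [Fintype α] (G : SimpleGraph α) (k ℓ : ℕ) (lam : ℝ)
    (x : α → ℝ) : Prop where
  k_pos : 1 ≤ k
  k_le : k ≤ ℓ
  sparse : IsSparse ℓ G
  biclique : ∀ S B : Finset α, #S = k + 1 → (∀ s ∈ S, ∀ b ∈ B, G.Adj s b) → #B < ℓ
  nonneg : ∀ v, 0 ≤ x v
  le_one : ∀ v, x v ≤ 1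
  exists_one : ∃ z, x z = 1
  lam_nonneg : 0 ≤ lam
  lam_sq : (k : ℝ) * (Fintype.card α - k) ≤ lam ^ 2
  eigen : ∀ v, ∑ u, adjInd G v u * x u = lam * x v

namespace PerronData

variable {α : Type*} [Fintype α] {G : SimpleGraph α} {k ℓ : ℕ} {lam : ℝ} {x : α → ℝ}

lemma card_pos (h : PerronData G k ℓ lam x) : (0 : ℝ) < Fintype.card α := by
  obtain ⟨z, -⟩ := h.exists_one
  exact_mod_cast Fintype.card_pos_iff.2 ⟨z⟩

lemma sum_le (h : PerronData G k ℓ lam x) :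
    ∑ u, ∑ v, adjInd G u v ≤ 2 * ℓ * Fintype.card α := by
  simpa using h.sparse univ

/-- Splitting the walks of length two from `v` according to the weight of their end. -/
lemma lam_sq_mul_le (h : PerronData G k ℓ lam x) (ε : ℝ) (hε : 0 ≤ ε) (v : α) :
    lam ^ 2 * x v ≤ ∑ u, adjInd G v u * ∑ w ∈ univ.filter (fun w => ε ≤ x w), adjInd G u w * x w
      + 2 * ℓ * ε * Fintype.card α := by
  have e1 : lam ^ 2 * x v = ∑ u, adjInd G v u * ∑ w, adjInd G u w * x w := by
    simp only [h.eigen]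
    calc lam ^ 2 * x v = lam * (lam * x v) := by ring
      _ = ∑ u, adjInd G v u * (lam * x u) := by
        rw [← h.eigen v, mul_sum]
        exact sum_congr rfl fun u _ => by ring
  have e2 : ∀ u, ∑ w, adjInd G u w * x w ≤
      ∑ w ∈ univ.filter (fun w => ε ≤ x w), adjInd G u w * x w + ε * ∑ w, adjInd G u w := by
    intro u
    rw [sum_filter, mul_sum, ← sum_add_distrib]
    refine sum_le_sum fun w _ => ?_
    have ha := adjInd_nonneg G u w
    split_ifs with hw
    · nlinarith
    · push Not at hw
      nlinarith
  rw [e1]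
  calc ∑ u, adjInd G v u * ∑ w, adjInd G u w * x w
      ≤ ∑ u, (adjInd G v u * ∑ w ∈ univ.filter (fun w => ε ≤ x w), adjInd G u w * x w
          + ε * ∑ w, adjInd G u w) := by
        refine sum_le_sum fun u _ => ?_
        have h1 := mul_le_mul_of_nonneg_left (e2 u) (adjInd_nonneg G v u)
        have h2 : 0 ≤ ε * ∑ w, adjInd G u w :=
          mul_nonneg hε (sum_nonneg fun w _ => adjInd_nonneg G u w)
        have h3 := mul_le_mul_of_nonneg_right (adjInd_le_one G v u) h2
        linarith
    _ = ∑ u, adjInd G v u * ∑ w ∈ univ.filter (fun w => ε ≤ x w), adjInd G u w * x w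
          + ε * ∑ u, ∑ w, adjInd G u w := by
        rw [sum_add_distrib, ← mul_sum]
    _ ≤ _ := by nlinarith [h.sum_le]

/-- The eigenvalue equation gives a vertex of weight at least `ε` a degree of at least `ε * lam`,
and the degree sum is linear in the order. -/
lemma mul_card_le (h : PerronData G k ℓ lam x) (ε : ℝ) :
    ε * lam * #(univ.filter (fun w => ε ≤ x w)) ≤ 2 * ℓ * Fintype.card α := by
  calc ε * lam * #(univ.filter (fun w => ε ≤ x w))
      = ∑ v ∈ univ.filter (fun w => ε ≤ x w), ε * lam := by
        rw [sum_const, nsmul_eq_mul]; ring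
    _ ≤ ∑ v ∈ univ.filter (fun w => ε ≤ x w), ∑ u, adjInd G v u := by
        refine sum_le_sum fun v hv => ?_
        have hv' : ε ≤ x v := (mem_filter.1 hv).2
        have h1 := mul_le_mul_of_nonneg_left hv' h.lam_nonneg
        calc ε * lam ≤ lam * x v := by linarith
          _ = ∑ u, adjInd G v u * x u := (h.eigen v).symm
          _ ≤ ∑ u, adjInd G v u := sum_le_sum fun u _ =>
            mul_le_of_le_one_right (adjInd_nonneg G v u) (h.le_one u)
    _ ≤ ∑ v, ∑ u, adjInd G v u :=
        sum_le_sum_of_subset_of_nonneg (subset_univ _)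
          fun v _ _ => sum_nonneg fun u _ => adjInd_nonneg G v u
    _ ≤ _ := h.sum_le

/-- The walks of length two from `v` to heavy vertices are edges between the neighbourhood of `v`
and the heavy set; sparsity makes their number linear in the two sizes. -/
lemma lam_sq_mul_le_degree (h : PerronData G k ℓ lam x) (ε : ℝ) (hε : 0 ≤ ε) (v : α) :
    lam ^ 2 * x v ≤ 2 * ℓ * (∑ u, adjInd G v u + #(univ.filter (fun w => ε ≤ x w)))
      + 2 * ℓ * ε * Fintype.card α := by
  classical
  refine (h.lam_sq_mul_le ε hε v).trans (add_le_add_left ?_ _)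
  set L := univ.filter (fun w => ε ≤ x w)
  calc ∑ u, adjInd G v u * ∑ w ∈ L, adjInd G u w * x w
      ≤ ∑ u, adjInd G v u * ∑ w ∈ L, adjInd G u w := by
        refine sum_le_sum fun u _ => mul_le_mul_of_nonneg_left ?_ (adjInd_nonneg G v u)
        exact sum_le_sum fun w _ => mul_le_of_le_one_right (adjInd_nonneg G u w) (h.le_one w)
    _ = ∑ u ∈ univ.filter (G.Adj v), ∑ w ∈ L, adjInd G u w := by
        rw [sum_filter]
        refine sum_congr rfl fun u _ => ?_
        split_ifs with huv
        · rw [adjInd_of_adj huv, one_mul]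
        · rw [adjInd_of_not_adj huv, zero_mul]
    _ ≤ 2 * ℓ * (#(univ.filter (G.Adj v)) + #L) := h.sparse.sum_le _ _
    _ = _ := by rw [sum_adjInd_eq_card]

/-- There are boundedly many vertices of weight at least `η`. -/
lemma card_mul_le (h : PerronData G k ℓ lam x) {η : ℝ} (hη : 0 < η)
    (hn : 2 * k ≤ Fintype.card α) (hlam : 512 * (ℓ : ℝ) ^ 3 ≤ lam * η ^ 2) :
    #(univ.filter (fun w => η ≤ x w)) * η ≤ 16 * (ℓ : ℝ) ^ 2 := by
  have hn0 := h.card_pos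
  set n : ℝ := (Fintype.card α : ℝ) with hnd
  have hk1 : (1 : ℝ) ≤ k := by exact_mod_cast h.k_pos
  have hℓ1 : (1 : ℝ) ≤ ℓ := by exact_mod_cast h.k_pos.trans h.k_le
  have hnk : 2 * (k : ℝ) ≤ n := by rw [hnd]; exact_mod_cast hn
  have hlam2 : n / 2 ≤ lam ^ 2 := by
    have := h.lam_sq
    nlinarith
  have hlampos : 0 < lam := by
    by_contra hc
    have : lam * η ^ 2 ≤ 0 := mul_nonpos_of_nonpos_of_nonneg (not_lt.1 hc) (sq_nonneg _)
    have : (0 : ℝ) < 512 * (ℓ : ℝ) ^ 3 := by positivity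
    linarith
  -- With this `ε` each of the two error terms in the degree estimate is at most `η * n / 8`,
  -- against a main term of at least `η * n / 2`. Vertices of weight `η` thus have linear degree,
  -- and sparsity allows only boundedly many.
  set ε := η / (16 * ℓ) with hεd
  have hε : 0 < ε := by positivity
  have hεℓ : 16 * ℓ * ε = η := by rw [hεd]; field_simp
  set c : ℝ := (#(univ.filter (fun w => ε ≤ x w)) : ℝ) with hc
  have hc0 : 0 ≤ c := by rw [hc]; positivity
  have h1 : ε * lam * c ≤ 2 * ℓ * n := h.mul_card_le ε
  have h2 : 2 * ℓ * c ≤ η * n / 8 := by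
    have hpos : 0 < η * lam := mul_pos hη hlampos
    refine le_of_mul_le_mul_left ?_ hpos
    calc η * lam * (2 * ℓ * c) = 32 * ℓ ^ 2 * (ε * lam * c) := by rw [← hεℓ]; ring
      _ ≤ 32 * ℓ ^ 2 * (2 * ℓ * n) := by gcongr
      _ = 512 * (ℓ : ℝ) ^ 3 * n / 8 := by ring
      _ ≤ lam * η ^ 2 * n / 8 := by gcongr
      _ = _ := by ring
  have hdeg : ∀ v, η ≤ x v → η * n ≤ 8 * ℓ * ∑ u, adjInd G v u := by
    intro v hv
    have h3 := h.lam_sq_mul_le_degree ε hε.le v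
    have h4 : n / 2 * η ≤ lam ^ 2 * x v := by gcongr
    have h5 : 2 * ℓ * ε * n = η * n / 8 := by rw [← hεℓ]; ring
    rw [← hnd, ← hc, h5] at h3
    linarith
  have h6 : #(univ.filter (fun w => η ≤ x w)) * (η * n) ≤ 8 * ℓ * (2 * ℓ * n) := by
    calc #(univ.filter (fun w => η ≤ x w)) * (η * n)
        = ∑ v ∈ univ.filter (fun w => η ≤ x w), η * n := by rw [sum_const, nsmul_eq_mul]
      _ ≤ ∑ v ∈ univ.filter (fun w => η ≤ x w), 8 * ℓ * ∑ u, adjInd G v u :=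
          sum_le_sum fun v hv => hdeg v (mem_filter.1 hv).2
      _ ≤ ∑ v, 8 * ℓ * ∑ u, adjInd G v u :=
          sum_le_sum_of_subset_of_nonneg (subset_univ _) fun v _ _ =>
            mul_nonneg (by positivity) (sum_nonneg fun u _ => adjInd_nonneg G v u)
      _ = 8 * ℓ * ∑ v, ∑ u, adjInd G v u := by rw [mul_sum]
      _ ≤ _ := by
          have := h.sum_le
          gcongr
  refine le_of_mul_le_mul_right ?_ hn0
  calc _ = #(univ.filter (fun w => η ≤ x w)) * (η * n) := by ring
    _ ≤ _ := h6
    _ = _ := by ring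

open Classical in
/-- Few vertices have more than `k` neighbours in `L`. -/
lemma card_exceptional_le (h : PerronData G k ℓ lam x) (L : Finset α) :
    #(univ.filter fun u => k + 1 ≤ #{w ∈ L | G.Adj u w}) ≤ 2 ^ #L * ℓ := by
  have hsub : (univ.filter fun u => k + 1 ≤ #{w ∈ L | G.Adj u w}) ⊆
      (powersetCard (k + 1) L).biUnion fun S => univ.filter fun u => ∀ s ∈ S, G.Adj s u := by
    intro u hu
    obtain ⟨S, hS, hcard⟩ := exists_subset_card_eq (mem_filter.1 hu).2
    refine mem_biUnion.2 ⟨S, mem_powersetCard.2 ⟨hS.trans (filter_subset _ _), hcard⟩, ?_⟩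
    refine mem_filter.2 ⟨mem_univ u, fun s hs => ?_⟩
    exact ((mem_filter.1 (hS hs)).2).symm
  refine (card_le_card hsub).trans ?_
  refine (card_biUnion_le_card_mul _ _ ℓ fun S hS => ?_).trans ?_
  · refine (h.biclique S _ (mem_powersetCard.1 hS).2 fun s hs b hb => ?_).le
    exact (mem_filter.1 hb).2 s hs
  · refine Nat.mul_le_mul_right _ ?_
    rw [← card_powerset]
    exact card_le_card fun S hS => mem_powerset.2 (mem_powersetCard.1 hS).1

/-- The constants used in the structure theorem. -/
structure Large (k ℓ K : ℕ) (η lam n : ℝ) : Prop where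
  eta_pos : 0 < η
  eta_le : 100 * (ℓ : ℝ) ^ 3 * η ≤ 1
  two_mul_le : 2 * (k : ℝ) ≤ n
  lam_large : 512 * (ℓ : ℝ) ^ 3 ≤ lam * η ^ 2
  K_large : 16 * (ℓ : ℝ) ^ 2 ≤ K * η
  n_large : (K : ℝ) * (2 ^ K * ℓ) + k ^ 2 ≤ ℓ * η * n
  ell_le : 2 * (ℓ : ℝ) ≤ ℓ ^ 2 * η * n

open Classical in
/-- There are `k` vertices of weight and relative degree close to one, and the weight of every
vertex is controlled by its degree. -/
lemma exists_heavy (h : PerronData G k ℓ lam x) {K : ℕ} {η : ℝ}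
    (hl : Large k ℓ K η lam (Fintype.card α)) :
    (∀ v, Fintype.card α * x v ≤ ∑ u, adjInd G v u + 3 * ℓ * η * Fintype.card α) ∧
    ∃ S : Finset α, #S = k ∧ ∀ w ∈ S, 1 - 4 * ℓ * η ≤ x w := by
  have hn0 := h.card_pos
  have hη := hl.eta_pos
  have hk1 : (1 : ℝ) ≤ k := by exact_mod_cast h.k_pos
  have hℓ1 : (1 : ℝ) ≤ ℓ := by exact_mod_cast h.k_pos.trans h.k_le
  set L := univ.filter (fun w => η ≤ x w) with hL
  set X := univ.filter (fun u => k + 1 ≤ #{w ∈ L | G.Adj u w}) with hX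
  have hLK : #L ≤ K := by
    have h1 := h.card_mul_le hη (by exact_mod_cast hl.two_mul_le) hl.lam_large
    have h2 : (#L : ℝ) * η ≤ K * η := h1.trans hl.K_large
    exact_mod_cast le_of_mul_le_mul_right h2 hη
  have hXc : (#X : ℝ) ≤ 2 ^ K * ℓ := by
    have h1 := h.card_exceptional_le L
    have h2 : 2 ^ #L * ℓ ≤ 2 ^ K * ℓ :=
      Nat.mul_le_mul_right _ (Nat.pow_le_pow_right (by norm_num) hLK)
    exact_mod_cast h1.trans h2
  set n : ℝ := (Fintype.card α : ℝ) with hnd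
  -- This is the total weight of the heavy neighbours of `u`. It is at most `k` off `X`; the
  -- vertices of `X` contribute at most `K * (2 ^ K * ℓ)` in all, which `n_large` absorbs.
  set ω : α → ℝ := fun u => ∑ w ∈ L, adjInd G u w * x w with hω
  have hω0 : ∀ u, 0 ≤ ω u := fun u =>
    sum_nonneg fun w _ => mul_nonneg (adjInd_nonneg G u w) (h.nonneg w)
  have hωcard : ∀ u, ω u ≤ #{w ∈ L | G.Adj u w} := by
    intro u
    rw [← sum_adjInd_eq_card]
    exact sum_le_sum fun w _ => mul_le_of_le_one_right (adjInd_nonneg G u w) (h.le_one w)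
  have hωk : ∀ u, u ∉ X → #{w ∈ L | G.Adj u w} ≤ k := by
    intro u hu
    simp only [hX, mem_filter, mem_univ, true_and, not_le] at hu
    omega
  have hωK : ∀ u, ω u ≤ K := by
    intro u
    refine (hωcard u).trans ?_
    exact_mod_cast (card_le_card (filter_subset _ _)).trans hLK
  have hwalk : ∀ v, lam ^ 2 * x v ≤ ∑ u, adjInd G v u * ω u + 2 * ℓ * η * n :=
    fun v => h.lam_sq_mul_le η hη.le v
  have hbound : ∀ (v : α) (κ : ℝ) (_ : 0 ≤ κ) (_ : ∀ u, u ∉ X → ω u ≤ κ),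
      ∑ u, adjInd G v u * ω u ≤ κ * ∑ u, adjInd G v u + K * (2 ^ K * ℓ) := by
    intro v κ hκ hu
    calc ∑ u, adjInd G v u * ω u
        ≤ ∑ u, (κ * adjInd G v u + if u ∈ X then (K : ℝ) else 0) := by
          refine sum_le_sum fun u _ => ?_
          have ha := adjInd_nonneg G v u
          have ha1 := adjInd_le_one G v u
          split_ifs with hux
          · have h1 : adjInd G v u * ω u ≤ ω u := mul_le_of_le_one_left (hω0 u) ha1
            have h2 := hωK u
            have h3 := mul_nonneg hκ ha
            linarith
          · have := mul_le_mul_of_nonneg_left (hu u hux) ha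
            linarith
      _ = κ * ∑ u, adjInd G v u + #X * K := by
          rw [sum_add_distrib, ← mul_sum]
          simp
      _ ≤ κ * ∑ u, adjInd G v u + 2 ^ K * ℓ * K := by gcongr
      _ = _ := by ring
  have hC := hl.n_large
  have hlam2 := h.lam_sq
  rw [← hnd] at hlam2
  refine ⟨fun v => ?_, ?_⟩
  · have h1 := hwalk v
    have h2 := hbound v k (by positivity)
      fun u hu => (hωcard u).trans (by exact_mod_cast hωk u hu)
    have h3 := mul_le_mul_of_nonneg_right hlam2 (h.nonneg v)
    have h4 : (k : ℝ) ^ 2 * x v ≤ k ^ 2 := mul_le_of_le_one_right (by positivity) (h.le_one v)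
    have h5 : (k : ℝ) * (n * x v) ≤ k * (∑ u, adjInd G v u) + 3 * ℓ * η * n := by nlinarith
    have h6 : 3 * ℓ * η * n ≤ k * (3 * ℓ * η * n) :=
      le_mul_of_one_le_left (by positivity) hk1
    refine le_of_mul_le_mul_left ?_ (by linarith : (0 : ℝ) < k)
    linarith
  · have hδ : 4 * ℓ * η < 1 := by
      have h1 : (ℓ : ℝ) ≤ ℓ ^ 3 := by
        calc (ℓ : ℝ) = ℓ ^ 1 := (pow_one _).symm
          _ ≤ ℓ ^ 3 := pow_le_pow_right₀ hℓ1 (by norm_num)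
      have h2 : ℓ * η ≤ ℓ ^ 3 * η := by gcongr
      have := hl.eta_le
      have h3 : 0 < ℓ * η := by positivity
      nlinarith
    -- Otherwise, at a vertex of weight one, the walk count would fall short of `k (n - k)` by at
    -- least `ℓ * η * n`.
    obtain ⟨u, huX, hu⟩ : ∃ u, u ∉ X ∧ k - 4 * ℓ * η ≤ ω u := by
      by_contra hcon
      push Not at hcon
      obtain ⟨z, hz⟩ := h.exists_one
      have h1 := hwalk z
      have h2 := hbound z (k - 4 * ℓ * η) (by linarith) fun u hu => (hcon u hu).le
      have h3 : ∑ u, adjInd G z u ≤ n := by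
        calc ∑ u, adjInd G z u ≤ ∑ _u : α, (1 : ℝ) := sum_le_sum fun u _ => adjInd_le_one G z u
          _ = n := by simp [hnd]
      have h4 : (k - 4 * ℓ * η) * ∑ u, adjInd G z u ≤ (k - 4 * ℓ * η) * n :=
        mul_le_mul_of_nonneg_left h3 (by linarith)
      rw [hz] at h1
      have h5 : 0 < ℓ * η * n := by positivity
      nlinarith
    have hωS : ω u = ∑ w ∈ {w ∈ L | G.Adj u w}, x w := by
      rw [hω, sum_filter]
      refine sum_congr rfl fun w _ => ?_
      split_ifs with huw
      · rw [adjInd_of_adj huw, one_mul]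
      · rw [adjInd_of_not_adj huw, zero_mul]
    have hcard : #{w ∈ L | G.Adj u w} = k := by
      refine le_antisymm (hωk u huX) ?_
      have h1 := hu.trans (hωcard u)
      have h2 : (k : ℝ) < #{w ∈ L | G.Adj u w} + 1 := by linarith
      exact Nat.lt_succ_iff.1 (by exact_mod_cast h2)
    refine ⟨{w ∈ L | G.Adj u w}, hcard, fun w hw => ?_⟩
    -- The other `k - 1` heavy neighbours weigh at most one each, so the whole deficit `4 * ℓ * η`
    -- bounds that of the single vertex `w`.
    have h1 : ∑ w' ∈ {w ∈ L | G.Adj u w}.erase w, x w' ≤ k - 1 := by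
      calc ∑ w' ∈ {w ∈ L | G.Adj u w}.erase w, x w'
          ≤ ∑ w' ∈ {w ∈ L | G.Adj u w}.erase w, 1 := sum_le_sum fun w' _ => h.le_one w'
        _ = k - 1 := by
          rw [sum_const, card_erase_of_mem hw, hcard, nsmul_eq_mul, mul_one,
            Nat.cast_sub h.k_pos, Nat.cast_one]
    rw [hωS, ← add_sum_erase _ _ hw] at hu
    linarith

open Classical in
/-- Almost all vertices are joined to the `k` heavy vertices, and all other vertices are light. -/
lemma exists_heavy_common (h : PerronData G k ℓ lam x) {K : ℕ} {η : ℝ}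
    (hl : Large k ℓ K η lam (Fintype.card α)) :
    ∃ S : Finset α, #S = k ∧ (∀ w ∈ S, 1 - 4 * ℓ * η ≤ x w) ∧
      ℓ ≤ #(univ.filter fun b => ∀ s ∈ S, G.Adj s b) ∧
      ∀ v, v ∉ S → x v ≤ 11 * ℓ ^ 2 * η ∧
        #{b ∈ univ.filter (fun b => ∀ s ∈ S, G.Adj s b) | G.Adj v b} < ℓ := by
  have hn0 := h.card_pos
  have hη := hl.eta_pos
  have hℓ1 : (1 : ℝ) ≤ ℓ := by exact_mod_cast h.k_pos.trans h.k_le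
  have hkℓ : (k : ℝ) ≤ ℓ := by exact_mod_cast h.k_le
  obtain ⟨hdeg, S, hSk, hSx⟩ := h.exists_heavy hl
  set n : ℝ := (Fintype.card α : ℝ) with hnd
  set B := univ.filter (fun b => ∀ s ∈ S, G.Adj s b) with hB
  -- By `hdeg`, weight `1 - 4 * ℓ * η` forces degree at least `(1 - 7 * ℓ * η) * n`. Each of the `k
  -- ≤ ℓ` vertices of `S` thus misses at most `7 * ℓ * η * n` vertices.
  have hBc : (#Bᶜ : ℝ) ≤ 7 * ℓ ^ 2 * η * n := by
    have hsub : Bᶜ ⊆ S.biUnion fun s => univ.filter fun b => ¬ G.Adj s b := by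
      intro b hb
      simp only [hB, mem_compl, mem_filter, mem_univ, true_and, not_forall] at hb
      obtain ⟨s, hs, hsb⟩ := hb
      exact mem_biUnion.2 ⟨s, hs, by simpa using hsb⟩
    have h1 : #Bᶜ ≤ ∑ s ∈ S, #(univ.filter fun b => ¬ G.Adj s b) :=
      (card_le_card hsub).trans card_biUnion_le
    have h2 : ∀ s ∈ S, (#(univ.filter fun b => ¬ G.Adj s b) : ℝ) ≤ 7 * ℓ * η * n := by
      intro s hs
      have h3 := card_filter_add_card_filter_not (s := (univ : Finset α)) (fun b => G.Adj s b)
      have h4 : (#(univ.filter fun b => G.Adj s b) : ℝ) + #(univ.filter fun b => ¬ G.Adj s b)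
          = n := by
        rw [hnd, ← card_univ]; exact_mod_cast h3
      have h5 := hdeg s
      rw [sum_adjInd_eq_card] at h5
      have h6 := mul_le_mul_of_nonneg_left (hSx s hs) hn0.le
      linarith
    calc (#Bᶜ : ℝ) ≤ ∑ s ∈ S, (#(univ.filter fun b => ¬ G.Adj s b) : ℝ) := by exact_mod_cast h1
      _ ≤ ∑ s ∈ S, 7 * ℓ * η * n := sum_le_sum h2
      _ = k * (7 * ℓ * η * n) := by rw [sum_const, hSk, nsmul_eq_mul]
      _ ≤ ℓ * (7 * ℓ * η * n) := by gcongr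
      _ = _ := by ring
  have hsq : 100 * (ℓ : ℝ) ^ 2 * η ≤ 1 := by
    refine le_trans ?_ hl.eta_le
    have : (ℓ : ℝ) ^ 2 ≤ ℓ ^ 3 := pow_le_pow_right₀ hℓ1 (by norm_num)
    gcongr
  have hell := hl.ell_le
  refine ⟨S, hSk, hSx, ?_, fun v hv => ?_⟩
  · have h1 : (#B : ℝ) + #Bᶜ = n := by
      rw [hnd]; exact_mod_cast card_add_card_compl B
    have h2 : 100 * (ℓ : ℝ) ^ 2 * η * n ≤ 1 * n := by gcongr
    have h3 : (ℓ : ℝ) ≤ #B := by linarith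
    exact_mod_cast h3
  · have hlt : #{b ∈ B | G.Adj v b} < ℓ := by
      refine h.biclique (insert v S) _ (by rw [card_insert_of_notMem hv, hSk]) ?_
      intro s hs b hb
      rw [mem_filter, hB, mem_filter] at hb
      rcases mem_insert.1 hs with rfl | hs
      · exact hb.2
      · exact hb.1.2 s hs
    refine ⟨?_, hlt⟩
    -- A vertex outside `S` has fewer than `ℓ` neighbours in `B`, so its degree, and through `hdeg`
    -- its weight, is small.
    have h1 : ∑ u, adjInd G v u ≤ ℓ + 7 * ℓ ^ 2 * η * n := by
      rw [sum_adjInd_eq_card]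
      have hsub : univ.filter (G.Adj v) ⊆ {b ∈ B | G.Adj v b} ∪ Bᶜ := by
        intro b hb
        by_cases hbB : b ∈ B
        · exact mem_union_left _ (mem_filter.2 ⟨hbB, (mem_filter.1 hb).2⟩)
        · exact mem_union_right _ (mem_compl.2 hbB)
      have h2 := (card_le_card hsub).trans (card_union_le _ _)
      have h3 : (#(univ.filter (G.Adj v)) : ℝ) ≤ #{b ∈ B | G.Adj v b} + #Bᶜ := by
        exact_mod_cast h2
      have h4 : (#{b ∈ B | G.Adj v b} : ℝ) ≤ ℓ := by exact_mod_cast hlt.le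
      linarith
    have h2 := hdeg v
    have h3 : (ℓ : ℝ) * η * n ≤ ℓ ^ 2 * η * n := by
      have : (ℓ : ℝ) ≤ ℓ ^ 2 := by nlinarith
      gcongr
    have h4 : n * x v ≤ n * (11 * ℓ ^ 2 * η) := by nlinarith
    exact le_of_mul_le_mul_left h4 hn0

end PerronData

/-! ### The quadratic form after rejoining a vertex. -/

section Rejoin

variable {α : Type*} [Fintype α]

lemma sum_rejoin_self (G : SimpleGraph α) {v : α} {S : Finset α} (hv : v ∉ S) (y : α → ℝ) :
    ∑ w, adjInd (rejoin G v S) v w * y w = ∑ w ∈ S, y w := by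
  classical
  rw [← sum_filter_add_sum_filter_not univ (fun w => w ∈ S), filter_mem_eq_inter, univ_inter]
  rw [sum_eq_zero (s := univ.filter fun w => w ∉ S), add_zero]
  · refine sum_congr rfl fun w hw => ?_
    rw [adjInd_of_adj ((rejoin_adj_self G hv w).2 hw), one_mul]
  · intro w hw
    rw [adjInd_of_not_adj fun h => (mem_filter.1 hw).2 ((rejoin_adj_self G hv w).1 h), zero_mul]

lemma sum_rejoin_of_ne (G : SimpleGraph α) {v : α} {S : Finset α} {u : α} (hu : u ≠ v)
    (y : α → ℝ) :
    ∑ w, adjInd (rejoin G v S) u w * y w =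
      ∑ w, adjInd G u w * y w + (adjInd (rejoin G v S) u v - adjInd G u v) * y v := by
  classical
  have h1 : ∀ H : SimpleGraph α, ∑ w, adjInd H u w * y w =
      adjInd H u v * y v + ∑ w ∈ univ.erase v, adjInd H u w * y w :=
    fun H => (add_sum_erase _ _ (mem_univ v)).symm
  rw [h1, h1 G]
  have h2 : ∑ w ∈ univ.erase v, adjInd (rejoin G v S) u w * y w
      = ∑ w ∈ univ.erase v, adjInd G u w * y w := by
    refine sum_congr rfl fun w hw => ?_
    congr 1
    have hiff := rejoin_adj_of_ne G (S := S) hu (ne_of_mem_erase hw)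
    by_cases hG : G.Adj u w
    · rw [adjInd_of_adj hG, adjInd_of_adj (hiff.2 hG)]
    · rw [adjInd_of_not_adj hG, adjInd_of_not_adj fun h => hG (hiff.1 h)]
  rw [h2]
  ring

/-- Only the row and the column of `v` change, and by symmetry they contribute equally; hence the
factor two. -/
lemma quadForm_rejoin (G : SimpleGraph α) {v : α} {S : Finset α} (hv : v ∉ S) (y : α → ℝ) :
    quadForm (rejoin G v S) y =
      quadForm G y + 2 * y v * (∑ w ∈ S, y w - ∑ w, adjInd G v w * y w) := by
  classical
  have h1 : ∀ H : SimpleGraph α, quadForm H y = y v * ∑ w, adjInd H v w * y w +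
      ∑ u ∈ univ.erase v, y u * ∑ w, adjInd H u w * y w :=
    fun H => (add_sum_erase _ _ (mem_univ v)).symm
  have h2 : ∑ u ∈ univ.erase v, y u * ∑ w, adjInd (rejoin G v S) u w * y w =
      ∑ u ∈ univ.erase v, y u * ∑ w, adjInd G u w * y w +
      y v * (∑ u ∈ univ.erase v, adjInd (rejoin G v S) v u * y u -
        ∑ u ∈ univ.erase v, adjInd G v u * y u) := by
    rw [← sum_sub_distrib, mul_sum, ← sum_add_distrib]
    refine sum_congr rfl fun u hu => ?_
    rw [sum_rejoin_of_ne G (ne_of_mem_erase hu), adjInd_comm G u v, adjInd_comm _ u v]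
    ring
  have h3 : ∀ H : SimpleGraph α, ∑ u ∈ univ.erase v, adjInd H v u * y u =
      ∑ u, adjInd H v u * y u := by
    intro H
    rw [← add_sum_erase univ _ (mem_univ v), adjInd_of_not_adj H.irrefl, zero_mul, zero_add]
  rw [h1, h1 G, h2, h3, h3, sum_rejoin_self G hv]
  ring

end Rejoin

/-! ### The heavy vertices are joined to everything outside their set. -/

namespace PerronData

variable {α : Type*} [Fintype α] {G : SimpleGraph α} {k ℓ : ℕ} {x : α → ℝ}

open Classical in
/-- If rejoining a vertex never increases the spectral radius, then some `k` vertices are joined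
to all other vertices. -/
lemma exists_dominating (h : PerronData G k ℓ (specRadius G) x) {K : ℕ} {η : ℝ}
    (hl : Large k ℓ K η (specRadius G) (Fintype.card α))
    (hrej : ∀ (v : α) (S B : Finset α), v ∉ S → (∀ s ∈ S, ∀ b ∈ B, G.Adj s b) → ℓ ≤ #B →
      specRadius (rejoin G v S) ≤ specRadius G) :
    (∃ S : Finset α, #S = k ∧ ∀ s ∈ S, ∀ v, v ∉ S → G.Adj s v) ∧ ∀ v, 0 < x v := by
  have hη := hl.eta_pos
  have hℓ1 : (1 : ℝ) ≤ ℓ := by exact_mod_cast h.k_pos.trans h.k_le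
  obtain ⟨S, hSk, hSx, hBl, hlight⟩ := h.exists_heavy_common hl
  set B := univ.filter (fun b => ∀ s ∈ S, G.Adj s b) with hB
  have hSB : ∀ s ∈ S, ∀ b ∈ B, G.Adj s b := fun s hs b hb => (mem_filter.1 hb).2 s hs
  have hη3 := hl.eta_le
  have hδ : 4 * ℓ * η + 33 * ℓ ^ 3 * η ≤ 1 / 2 := by
    have h1 : (ℓ : ℝ) * η ≤ ℓ ^ 3 * η := by
      have : (ℓ : ℝ) ≤ ℓ ^ 3 := by
        calc (ℓ : ℝ) = ℓ ^ 1 := (pow_one _).symm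
          _ ≤ ℓ ^ 3 := pow_le_pow_right₀ hℓ1 (by norm_num)
      gcongr
    linarith
  have h33 : 0 < 33 * (ℓ : ℝ) ^ 3 * η := by positivity
  have hSpos : ∀ s ∈ S, 0 < x s := fun s hs => by linarith [hSx s hs]
  obtain ⟨s₀, hs₀⟩ : S.Nonempty := Finset.card_pos.1 (by rw [hSk]; exact h.k_pos)
  have hSsum : 0 < ∑ w ∈ S, x w := sum_pos hSpos ⟨s₀, hs₀⟩
  have hall : ∀ v, v ∉ S → v ∈ B := by
    by_contra hcon
    set E := univ.filter (fun v => v ∉ S ∧ v ∉ B) with hE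
    have hEne : E.Nonempty := by
      push Not at hcon
      obtain ⟨v, hv⟩ := hcon
      exact ⟨v, by simpa [hE] using hv⟩
    obtain ⟨v, hvE, hvd⟩ : ∃ v ∈ E, ∑ u ∈ E, adjInd G v u ≤ 2 * ℓ := by
      by_contra hc
      push Not at hc
      have h1 := sum_lt_sum_of_nonempty hEne hc
      have h2 := h.sparse E
      rw [sum_const, nsmul_eq_mul] at h1
      linarith
    obtain ⟨hvS, hvB⟩ := (mem_filter.1 hvE).2
    obtain ⟨w₀, hw₀, hvw⟩ : ∃ w ∈ S, ¬ G.Adj w v := by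
      simpa [hB] using hvB
    -- Outside `S`, the vertex `v` has at most `ℓ` neighbours in `B` and `2 * ℓ` in `E`, each of
    -- weight at most `11 * ℓ ^ 2 * η`. This is less than the weight of the missed vertex `w₀`.
    have hR : ∑ u ∈ Sᶜ, adjInd G v u * x u ≤ 33 * ℓ ^ 3 * η := by
      have e1 : ∑ u ∈ Sᶜ, adjInd G v u * x u ≤ ∑ u ∈ Sᶜ, adjInd G v u * (11 * ℓ ^ 2 * η) :=
        sum_le_sum fun u hu => mul_le_mul_of_nonneg_left (hlight u (mem_compl.1 hu)).1
          (adjInd_nonneg G v u)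
      have e2 : ∑ u ∈ Sᶜ, adjInd G v u ≤ ∑ u ∈ B, adjInd G v u + ∑ u ∈ E, adjInd G v u := by
        have hsub : Sᶜ ⊆ B ∪ E := by
          intro u hu
          by_cases huB : u ∈ B
          · exact mem_union_left _ huB
          · exact mem_union_right _ (mem_filter.2 ⟨mem_univ u, mem_compl.1 hu, huB⟩)
        refine (sum_le_sum_of_subset_of_nonneg hsub fun u _ _ => adjInd_nonneg G v u).trans ?_
        rw [← sum_union_inter]
        have := sum_nonneg (s := B ∩ E) fun u _ => adjInd_nonneg G v u
        linarith
      have e3 : ∑ u ∈ B, adjInd G v u ≤ ℓ := by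
        rw [sum_adjInd_eq_card]
        exact_mod_cast (hlight v hvS).2.le
      rw [← sum_mul] at e1
      have e4 : ∑ u ∈ Sᶜ, adjInd G v u ≤ 3 * ℓ := by linarith
      calc _ ≤ _ := e1
        _ ≤ 3 * ℓ * (11 * ℓ ^ 2 * η) := by gcongr
        _ = _ := by ring
    have hSle : ∑ u ∈ S, adjInd G v u * x u ≤ ∑ u ∈ S, x u - x w₀ := by
      rw [← add_sum_erase _ _ hw₀, ← add_sum_erase _ (fun u => x u) hw₀,
        adjInd_of_not_adj fun h' => hvw h'.symm]
      have : ∑ u ∈ S.erase w₀, adjInd G v u * x u ≤ ∑ u ∈ S.erase w₀, x u :=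
        sum_le_sum fun u _ => mul_le_of_le_one_left (h.nonneg u) (adjInd_le_one G v u)
      linarith
    have hle : ∑ u, adjInd G v u * x u ≤ ∑ u ∈ S, x u := by
      rw [← sum_add_sum_compl S]
      linarith [hSx w₀ hw₀]
    have hquad : quadForm G x = specRadius G * ∑ u, x u ^ 2 := by
      unfold quadForm
      simp only [h.eigen, mul_sum]
      exact sum_congr rfl fun u _ => by ring
    have hspec := hrej v S B hvS hSB hBl
    have hq : specRadius G * ∑ u, x u ^ 2 ≤ quadForm (rejoin G v S) x := by
      rw [quadForm_rejoin G hvS, hquad]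
      have := mul_nonneg (h.nonneg v) (sub_nonneg.2 hle)
      linarith
    have hsq : 0 < ∑ u, x u ^ 2 :=
      sum_pos' (fun u _ => sq_nonneg _) ⟨s₀, mem_univ _, pow_pos (hSpos s₀ hs₀) 2⟩
    -- Equality makes `x` an eigenvector of both graphs for the same eigenvalue. Comparing the
    -- equations at `w₀` gives `x v = 0`, and then the new equation at `v` makes the weight of `S`
    -- vanish.
    have heq : specRadius (rejoin G v S) = specRadius G := by
      refine le_antisymm hspec ?_
      exact le_of_mul_le_mul_right (hq.trans (quadForm_le _ x)) hsq
    have heig := eigen_of_quadForm_eq (rejoin G v S) x (by rw [heq]; exact hq)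
    have h1 := heig v
    rw [sum_rejoin_self G hvS, heq] at h1
    have hw₀v : w₀ ≠ v := fun h' => hvS (h' ▸ hw₀)
    have h2 := heig w₀
    rw [sum_rejoin_of_ne G hw₀v, h.eigen, heq, adjInd_of_not_adj hvw,
      adjInd_of_adj ((rejoin_adj_self G hvS w₀).2 hw₀).symm] at h2
    have h3 : x v = 0 := by linarith
    rw [h3, mul_zero] at h1
    linarith
  refine ⟨⟨S, hSk, fun s hs v hv => hSB s hs v (hall v hv)⟩, fun v => ?_⟩
  by_cases hv : v ∈ S
  · exact hSpos v hv
  · refine lt_of_le_of_ne (h.nonneg v) fun h0 => ?_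
    have h1 := h.eigen v
    rw [← h0, mul_zero] at h1
    have h2 := (sum_eq_zero_iff_of_nonneg fun u _ =>
      mul_nonneg (adjInd_nonneg G v u) (h.nonneg u)).1 h1 s₀ (mem_univ _)
    rw [adjInd_of_adj (hSB s₀ hs₀ v (hall v hv)).symm, one_mul] at h2
    linarith [hSpos s₀ hs₀]

/-- For large `n` the constants of the structure theorem can be chosen. -/
lemma exists_large (k ℓ : ℕ) (hk : 1 ≤ k) (hkℓ : k ≤ ℓ) :
    ∃ (N K : ℕ) (η : ℝ), ∀ (n : ℕ) (lam : ℝ), N ≤ n → 0 ≤ lam → (k : ℝ) * (n - k) ≤ lam ^ 2 →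
      Large k ℓ K η lam n := by
  have hk1 : (1 : ℝ) ≤ k := by exact_mod_cast hk
  have hℓ1 : (1 : ℝ) ≤ ℓ := by exact_mod_cast hk.trans hkℓ
  -- The largest value that `eta_le` permits. `K` follows from `η`, and each of the four summands in
  -- the bound for `N` serves one of the remaining requirements.
  set η : ℝ := 1 / (100 * (ℓ : ℝ) ^ 3) with hη
  have hη0 : 0 < η := by positivity
  obtain ⟨K, hK⟩ := exists_nat_ge (16 * (ℓ : ℝ) ^ 2 / η)
  obtain ⟨N, hN⟩ := exists_nat_ge (2 * (k : ℝ) + 2 * (512 * (ℓ : ℝ) ^ 3 / η ^ 2) ^ 2 +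
    ((K : ℝ) * (2 ^ K * ℓ) + k ^ 2) / (ℓ * η) + 2 * ℓ / (ℓ ^ 2 * η))
  refine ⟨N, K, η, fun n lam hn hlam hsq => ?_⟩
  have hn' : (N : ℝ) ≤ n := by exact_mod_cast hn
  have p1 : 0 ≤ 2 * (512 * (ℓ : ℝ) ^ 3 / η ^ 2) ^ 2 := by positivity
  have p2 : 0 ≤ ((K : ℝ) * (2 ^ K * ℓ) + k ^ 2) / (ℓ * η) := by positivity
  have p3 : 0 ≤ 2 * (ℓ : ℝ) / (ℓ ^ 2 * η) := by positivity
  have hnk : 2 * (k : ℝ) ≤ n := by linarith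
  refine ⟨hη0, ?_, hnk, ?_, ?_, ?_, ?_⟩
  · rw [hη]; field_simp; exact le_rfl
  · rw [← div_le_iff₀ (by positivity)]
    refine le_of_sq_le_sq ?_ hlam
    nlinarith
  · rwa [← div_le_iff₀ hη0]
  · rw [← div_le_iff₀' (by positivity)]
    have : (0 : ℝ) ≤ 2 * k := by positivity
    linarith
  · rw [← div_le_iff₀' (by positivity)]
    have : (0 : ℝ) ≤ 2 * k := by positivity
    linarith

end PerronData

/-! ### Coordinates along the legs of a spider. -/

/-- A decomposition of `F` into legs: `g i j` is the vertex at distance `j` from the center `c` on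
the `i`-th leg, which has length `m i`. -/
structure LegSystem {V ι : Type*} (F : SimpleGraph V) (c : V) (m : ι → ℕ) (g : ι → ℕ → V) :
    Prop where
  zero : ∀ i, g i 0 = c
  pos : ∀ i, 1 ≤ m i
  inj : ∀ {i i' j j'}, 1 ≤ j → j ≤ m i → 1 ≤ j' → j' ≤ m i' → g i j = g i' j' → i = i' ∧ j = j'
  ne : ∀ {i j}, 1 ≤ j → j ≤ m i → g i j ≠ c
  surj : ∀ v, v = c ∨ ∃ i j, 1 ≤ j ∧ j ≤ m i ∧ v = g i j
  adj : ∀ {i j}, j < m i → F.Adj (g i j) (g i (j + 1))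
  edge : ∀ {u v}, F.Adj u v →
    ∃ i j, j < m i ∧ ((u = g i j ∧ v = g i (j + 1)) ∨ (v = g i j ∧ u = g i (j + 1)))

lemma eq_or_eq_of_degree_le_two {V : Type*} [Fintype V] {F : SimpleGraph V} [DecidableRel F.Adj]
    {u a b v : V} (hu : F.degree u ≤ 2) (ha : F.Adj u a) (hb : F.Adj u b) (hab : a ≠ b)
    (hv : F.Adj u v) : v = a ∨ v = b := by
  classical
  by_contra hcon
  push Not at hcon
  have hsub : ({v, a, b} : Finset V) ⊆ F.neighborFinset u := by
    intro w hw
    simp only [mem_insert, mem_singleton] at hw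
    rw [SimpleGraph.mem_neighborFinset]
    rcases hw with rfl | rfl | rfl <;> assumption
  have h1 := card_le_card hsub
  rw [SimpleGraph.card_neighborFinset_eq_degree, card_eq_three.2
    ⟨v, a, b, hcon.1, hcon.2, hab, rfl⟩] at h1
  omega

lemma eq_of_degree_eq_one {V : Type*} [Fintype V] {F : SimpleGraph V} [DecidableRel F.Adj]
    {u a v : V} (hu : F.degree u = 1) (ha : F.Adj u a) (hv : F.Adj u v) : v = a := by
  rw [← SimpleGraph.card_neighborFinset_eq_degree, card_eq_one] at hu
  obtain ⟨w, hw⟩ := hu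
  have h1 : a ∈ F.neighborFinset u := (SimpleGraph.mem_neighborFinset _ _ _).2 ha
  have h2 : v ∈ F.neighborFinset u := (SimpleGraph.mem_neighborFinset _ _ _).2 hv
  rw [hw, mem_singleton] at h1 h2
  rw [h1, h2]

/-- In a tree all of whose vertices except `c` have degree at most two, the number of leaves is the
degree of `c`. -/
lemma card_leaves_eq_degree {V : Type*} [Fintype V] {F : SimpleGraph V} [DecidableRel F.Adj]
    {c : V} (hF : F.IsTree) (hc : 2 ≤ F.degree c) (hdeg : ∀ v, v ≠ c → F.degree v ≤ 2) :
    #(univ.filter fun v => F.degree v = 1) = F.degree c := by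
  classical
  have : Nontrivial V := by
    obtain ⟨w, hw⟩ := card_pos.1 (by rw [SimpleGraph.card_neighborFinset_eq_degree]; omega :
      0 < #(F.neighborFinset c))
    exact ⟨c, w, ((SimpleGraph.mem_neighborFinset _ _ _).1 hw).ne⟩
  have h1 := F.sum_degrees_eq_twice_card_edges
  have h2 := hF.card_edgeFinset
  -- Away from `c` every degree is one or two, so the handshake identity for a tree turns into a
  -- count of leaves.
  have h3 : ∀ v ∈ univ.erase c, F.degree v + (if F.degree v = 1 then 1 else 0) = 2 := by
    intro v hv
    have := hdeg v (ne_of_mem_erase hv)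
    have := hF.connected.preconnected.degree_pos_of_nontrivial v
    split_ifs <;> omega
  have h4 := sum_congr rfl h3
  rw [sum_add_distrib, sum_const, card_erase_of_mem (mem_univ c), card_univ] at h4
  rw [← add_sum_erase _ _ (mem_univ c)] at h1
  rw [card_filter, ← add_sum_erase _ _ (mem_univ c), if_neg (by omega)]
  have : 0 < Fintype.card V := Fintype.card_pos
  simp only [smul_eq_mul] at h4
  omega

/-- Every spider has a leg system, indexed by its leaves. -/
lemma exists_legSystem {V : Type*} [Fintype V] {F : SimpleGraph V} [DecidableRel F.Adj] {c : V}
    (hF : IsSpider F) (hc : IsCenter F c) :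
    ∃ (m : {v : V // F.degree v = 1} → ℕ) (g : {v : V // F.degree v = 1} → ℕ → V),
      LegSystem F c m g ∧ 2 ≤ Fintype.card {v : V // F.degree v = 1} ∧
      ∀ P : ℕ → Prop, legCount F c P = {i | P (m i)}.ncard := by
  classical
  obtain ⟨htree, hcard, hsub⟩ := hF
  have hc2 : 2 ≤ F.degree c := by rcases hc with h | h <;> omega
  have hdeg : ∀ v, v ≠ c → F.degree v ≤ 2 := by
    intro v hv
    rcases hc with h | ⟨-, h⟩
    · by_contra hcon
      exact hv (hsub (show 3 ≤ F.degree v by omega) h)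
    · exact h v
  choose p hp huniq using htree.existsUnique_path c
  set m : {v : V // F.degree v = 1} → ℕ := fun i => (p i).length with hm
  set g : {v : V // F.degree v = 1} → ℕ → V := fun i j => (p i).getVert j with hg
  have hzero : ∀ i, g i 0 = c := fun i => (p i).getVert_zero
  have hend : ∀ i, g i (m i) = i := fun i => (p i).getVert_length
  have hne_c : ∀ i : {v : V // F.degree v = 1}, (i : V) ≠ c := by
    intro i h
    have := i.2
    rw [h] at this
    omega
  have hpos : ∀ i, 1 ≤ m i := by
    intro i
    by_contra hcon
    have h0 : m i = 0 := by omega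
    have := hend i
    rw [h0, hzero] at this
    exact hne_c i this.symm
  have hself : ∀ {i j j'}, j ≤ m i → j' ≤ m i → g i j = g i j' → j = j' :=
    fun {i j j'} h h' he => (hp i).getVert_injOn h h' he
  have hadj : ∀ {i j}, j < m i → F.Adj (g i j) (g i (j + 1)) :=
    fun {i j} h => (p i).adj_getVert_succ h
  have hne : ∀ {i j}, 1 ≤ j → j ≤ m i → g i j ≠ c := by
    intro i j h1 h2 h
    rw [← hzero i] at h
    have := hself h2 (Nat.zero_le _) h
    omega
  have hprefix : ∀ i j, p (g i j) = (p i).take j := fun i j =>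
    (huniq (g i j) _ ((hp i).take j)).symm
  have hdepth : ∀ {i j}, j ≤ m i → (p (g i j)).length = j := by
    intro i j h
    rw [hprefix, SimpleGraph.Walk.take_length]
    exact min_eq_left h
  have hpred : ∀ {i j t}, t ≤ j → (p (g i j)).getVert t = g i t := by
    intro i j t h
    rw [hprefix, SimpleGraph.Walk.take_getVert, min_eq_right h]
  -- A common vertex away from the center has the same predecessor on both legs and degree at most
  -- two, so the successors agree. It is not the end of leg `i'`, since a leaf has only one
  -- neighbour.
  have hforward : ∀ {i i' j}, 1 ≤ j → j < m i → j ≤ m i' → g i j = g i' j →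
      j < m i' ∧ g i (j + 1) = g i' (j + 1) := by
    intro i i' j h1 h2 h3 he
    have a1 : F.Adj (g i j) (g i (j - 1)) := by
      have := hadj (i := i) (j := j - 1) (by omega)
      rw [Nat.sub_add_cancel h1] at this
      exact this.symm
    have a2 : F.Adj (g i j) (g i (j + 1)) := hadj h2
    have hd : g i (j - 1) ≠ g i (j + 1) := fun h => by
      have := hself (by omega) (by omega) h
      omega
    have hlt : j < m i' := by
      refine lt_of_le_of_ne h3 fun hj => ?_
      have hleaf : F.degree (g i j) = 1 := by
        rw [he, hj, hend]; exact i'.2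
      exact hd (eq_of_degree_eq_one hleaf a2 a1)
    refine ⟨hlt, ?_⟩
    have hpe : g i (j - 1) = g i' (j - 1) := by
      rw [← hpred (i := i) (j := j) (by omega), he, hpred (by omega)]
    have a3 : F.Adj (g i j) (g i' (j + 1)) := by rw [he]; exact hadj hlt
    rcases eq_or_eq_of_degree_le_two (hdeg _ (hne h1 h2.le)) a1 a2 hd a3 with h | h
    · rw [hpe] at h
      have := hself (by omega) (by omega) h
      omega
    · exact h.symm
  have hiter : ∀ {i i' j}, 1 ≤ j → j ≤ m i' → g i j = g i' j → ∀ t, j + t ≤ m i →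
      j + t ≤ m i' ∧ g i (j + t) = g i' (j + t) := by
    intro i i' j h1 h3 he t
    induction t with
    | zero => intro _; exact ⟨h3, he⟩
    | succ t ih =>
      intro ht
      obtain ⟨h4, h5⟩ := ih (by omega)
      obtain ⟨h6, h7⟩ := hforward (by omega) (by omega) h4 h5
      exact ⟨by omega, h7⟩
  have hinj : ∀ {i i' j j'}, 1 ≤ j → j ≤ m i → 1 ≤ j' → j' ≤ m i' → g i j = g i' j' →
      i = i' ∧ j = j' := by
    intro i i' j j' h1 h2 h1' h2' he
    have hjj : j = j' := by rw [← hdepth h2, he, hdepth h2']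
    subst hjj
    refine ⟨?_, rfl⟩
    obtain ⟨h3, h4⟩ := hiter h1 h2' he (m i - j) (by omega)
    rw [Nat.add_sub_cancel' h2] at h3 h4
    have h5 : m i' = m i := by
      refine le_antisymm ?_ h3
      by_contra hcon
      exact absurd (hforward (hpos i) (by omega) le_rfl h4.symm).1 (lt_irrefl _)
    rw [hend, ← h5, hend] at h4
    exact Subtype.ext h4
  have hcardι : Fintype.card {v : V // F.degree v = 1} = F.degree c := by
    rw [Fintype.card_subtype]
    exact card_leaves_eq_degree htree hc2 hdeg
  -- There are as many legs as neighbours of `c`, and distinct legs have distinct first vertices, so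
  -- no neighbour is left over.
  have hnbr : ∀ v, F.Adj c v → ∃ i, v = g i 1 := by
    have himg : univ.image (fun i => g i 1) = F.neighborFinset c := by
      refine eq_of_subset_of_card_le ?_ ?_
      · intro v hv
        obtain ⟨i, -, rfl⟩ := mem_image.1 hv
        rw [SimpleGraph.mem_neighborFinset]
        have := hadj (i := i) (j := 0) (hpos i)
        rwa [hzero] at this
      · rw [card_image_of_injective _ fun i i' h =>
          (hinj le_rfl (hpos i) le_rfl (hpos i') h).1, card_univ, hcardι,
          SimpleGraph.card_neighborFinset_eq_degree]
    intro v hv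
    rw [← SimpleGraph.mem_neighborFinset, ← himg] at hv
    obtain ⟨i, -, h⟩ := mem_image.1 hv
    exact ⟨i, h.symm⟩
  have hedge : ∀ {u v}, (u = c ∨ ∃ i j, 1 ≤ j ∧ j ≤ m i ∧ u = g i j) → F.Adj u v →
      ∃ i j, j < m i ∧ ((u = g i j ∧ v = g i (j + 1)) ∨ (v = g i j ∧ u = g i (j + 1))) := by
    rintro u v (rfl | ⟨i, j, h1, h2, rfl⟩) huv
    · obtain ⟨i, rfl⟩ := hnbr v huv
      exact ⟨i, 0, hpos i, Or.inl ⟨(hzero i).symm, rfl⟩⟩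
    · have a1 : F.Adj (g i j) (g i (j - 1)) := by
        have := hadj (i := i) (j := j - 1) (by omega)
        rw [Nat.sub_add_cancel h1] at this
        exact this.symm
      have hback : v = g i (j - 1) → ∃ i' j', j' < m i' ∧ ((g i j = g i' j' ∧ v = g i' (j' + 1)) ∨
          (v = g i' j' ∧ g i j = g i' (j' + 1))) := fun h =>
        ⟨i, j - 1, by omega, Or.inr ⟨h, by rw [Nat.sub_add_cancel h1]⟩⟩
      rcases h2.lt_or_eq with h3 | h3
      · have a2 : F.Adj (g i j) (g i (j + 1)) := hadj h3
        have hd : g i (j - 1) ≠ g i (j + 1) := fun h => by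
          have := hself (by omega) (by omega) h
          omega
        rcases eq_or_eq_of_degree_le_two (hdeg _ (hne h1 h2)) a1 a2 hd huv with h | h
        · exact hback h
        · exact ⟨i, j, h3, Or.inl ⟨rfl, h⟩⟩
      · have hleaf : F.degree (g i j) = 1 := by
          rw [h3, hend]; exact i.2
        exact hback (eq_of_degree_eq_one hleaf a1 huv)
  have hsurj : ∀ v, v = c ∨ ∃ i j, 1 ≤ j ∧ j ≤ m i ∧ v = g i j := by
    have hstep : ∀ u v, (u = c ∨ ∃ i j, 1 ≤ j ∧ j ≤ m i ∧ u = g i j) → F.Adj u v →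
        (v = c ∨ ∃ i j, 1 ≤ j ∧ j ≤ m i ∧ v = g i j) := by
      intro u v hu huv
      obtain ⟨i, j, h1, ⟨-, h2⟩ | ⟨h2, -⟩⟩ := hedge hu huv
      · exact Or.inr ⟨i, j + 1, by omega, h1, h2⟩
      · rcases Nat.eq_zero_or_pos j with rfl | hj
        · exact Or.inl (h2.trans (hzero i))
        · exact Or.inr ⟨i, j, hj, h1.le, h2⟩
    have hwalk : ∀ u v, F.Walk u v → (u = c ∨ ∃ i j, 1 ≤ j ∧ j ≤ m i ∧ u = g i j) →
        (v = c ∨ ∃ i j, 1 ≤ j ∧ j ≤ m i ∧ v = g i j) := by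
      intro u v w
      induction w with
      | nil => exact id
      | cons h _ ih => exact fun hu => ih (hstep _ _ hu h)
    exact fun v => hwalk c v (p v) (Or.inl rfl)
  refine ⟨m, g, ⟨hzero, hpos, hinj, hne, hsurj, hadj, fun h => hedge (hsurj _) h⟩, ?_, ?_⟩
  · rw [hcardι]; exact hc2
  · intro P
    unfold legCount
    rw [← Set.ncard_image_of_injective _ Subtype.val_injective]
    congr 1
    ext v
    simp only [Set.mem_ofPred_eq, Set.mem_image, Subtype.exists, exists_and_right, exists_eq_right]
    constructor
    · rintro ⟨h1, q, hq, hP⟩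
      refine ⟨h1, ?_⟩
      rwa [huniq v q hq] at hP
    · rintro ⟨h1, hP⟩
      exact ⟨h1, p v, hp v, hP⟩

/-! ### Deleting few vertices of `F`, and the resulting embeddings. -/

/-- Removing a suitable independent set of at most `k` vertices from `F` leaves only edges of the
pattern `P`. -/
def Splits {V κ : Type*} (F : SimpleGraph V) (k : ℕ) (P : κ → κ → Prop) : Prop :=
  ∃ (T : Finset V) (e : κ → V), #T ≤ k ∧ (∀ u ∈ T, ∀ v ∈ T, ¬ F.Adj u v) ∧
    Function.Injective e ∧
    ∀ u v, u ∉ T → v ∉ T → F.Adj u v → ∃ i j, P i j ∧ u = e i ∧ v = e j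

/-- The pattern of `q` disjoint edges. -/
def matchingPattern (q : ℕ) (a b : Fin q × Bool) : Prop := a.1 = b.1 ∧ a.2 ≠ b.2

/-- The pattern of a path on three vertices with middle vertex `1`. -/
def pathPattern (a b : Fin 3) : Prop := a ≠ b ∧ (a = 1 ∨ b = 1)

/-- The removed vertices go into `S`, and the edges that remain follow the copy `e'` of the pattern.
Each splitting of `F` thereby forbids its pattern among the vertices joined to `S`. -/
lemma Splits.isContained {V α κ : Type*} [Fintype V] [Finite κ] {F : SimpleGraph V} {k : ℕ}
    {P : κ → κ → Prop} (h : Splits F k P) {G : SimpleGraph α} {S B : Finset α} (hS : k ≤ #S)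
    (hSB : ∀ s ∈ S, ∀ b ∈ B, G.Adj s b) (hB : Fintype.card V ≤ #B) (e' : κ → α)
    (he' : Function.Injective e') (heB : ∀ i, e' i ∈ B) (hP : ∀ i j, P i j → G.Adj (e' i) (e' j)) :
    F.IsContained G := by
  classical
  have := Fintype.ofFinite κ
  obtain ⟨T, e, hT, hTind, he, hrest⟩ := h
  rcases isEmpty_or_nonempty V with hV | ⟨⟨v₀⟩⟩
  · exact SimpleGraph.IsContained.of_isEmpty
  obtain ⟨b₀, hb₀⟩ : B.Nonempty := card_pos.1
    (lt_of_lt_of_le (Fintype.card_pos_iff.2 ⟨v₀⟩) hB)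
  have hext : ∀ i, Function.extend e e' (fun _ => b₀) (e i) = e' i :=
    fun i => he.extend_apply _ _ i
  refine isContained_of_split F G S B hSB T (univ.image e) (Function.extend e e' fun _ => b₀)
    (hT.trans hS) hB ?_ ?_ hTind ?_
  · intro v hv
    obtain ⟨i, -, rfl⟩ := mem_image.1 hv
    rw [hext]; exact heB i
  · intro u hu v hv huv
    rw [mem_coe] at hu hv
    obtain ⟨i, -, rfl⟩ := mem_image.1 hu
    obtain ⟨j, -, rfl⟩ := mem_image.1 hv
    rw [hext, hext] at huv
    rw [he' huv]
  · intro u v hu hv huv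
    obtain ⟨i, j, hij, rfl, rfl⟩ := hrest u v hu hv huv
    refine ⟨mem_image_of_mem _ (mem_univ i), mem_image_of_mem _ (mem_univ j), ?_⟩
    rw [hext, hext]
    exact hP i j hij

lemma exists_perm_of_injective {κ β : Type*} [Finite κ] [Finite β] {ψ φ : κ → β}
    (hψ : Function.Injective ψ) (hφ : Function.Injective φ) :
    ∃ g : Equiv.Perm β, ∀ i, g (ψ i) = φ i := by
  classical
  have := Fintype.ofFinite κ
  have := Fintype.ofFinite β
  have hext : ∀ i, Function.extend ψ φ id (ψ i) = φ i := fun i => hψ.extend_apply _ _ i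
  obtain ⟨g, hg⟩ := Finset.exists_equiv_extend_of_card_eq (α := β) (t := (univ : Finset β))
    (by simp) (s := univ.image ψ) (f := Function.extend ψ φ id) (subset_univ _) (by
      intro u hu v hv huv
      rw [mem_coe] at hu hv
      obtain ⟨i, -, rfl⟩ := mem_image.1 hu
      obtain ⟨j, -, rfl⟩ := mem_image.1 hv
      rw [hext, hext] at huv
      rw [hφ huv])
  refine ⟨g.trans (Equiv.subtypeUnivEquiv (by simp)), fun i => ?_⟩
  have := hg (ψ i) (mem_image_of_mem _ (mem_univ i))
  rw [hext] at this
  simpa using this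

/-! ### Mapping a graph into `S_{n,k}^p`. -/

lemma graphS_adj_of_lt {n k p : ℕ} {u v : Fin n} (huv : u ≠ v) (hu : (u : ℕ) < k) :
    (graphS n k p).Adj u v := by
  rw [graphS, SimpleGraph.fromRel_adj]
  exact ⟨huv, Or.inl (Or.inl hu)⟩

lemma graphS_adj_pair {n k p i : ℕ} {u v : Fin n} (hi : i < p) (hu : (u : ℕ) = k + 2 * i)
    (hv : (v : ℕ) = k + 2 * i + 1) : (graphS n k p).Adj u v := by
  rw [graphS, SimpleGraph.fromRel_adj]
  exact ⟨fun h => by rw [h] at hu; omega, Or.inl (Or.inr ⟨i, hi, hu, hv⟩)⟩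

lemma graphS_adj_iff {n k p : ℕ} {u v : Fin n} (hu : k ≤ (u : ℕ)) (hv : k ≤ (v : ℕ)) :
    (graphS n k p).Adj u v ↔ ∃ i < p, ((u : ℕ) = k + 2 * i ∧ (v : ℕ) = k + 2 * i + 1) ∨
      ((v : ℕ) = k + 2 * i ∧ (u : ℕ) = k + 2 * i + 1) := by
  constructor
  · intro h
    rw [graphS, SimpleGraph.fromRel_adj] at h
    obtain ⟨-, (h | ⟨i, hi, h⟩) | (h | ⟨i, hi, h⟩)⟩ := h
    · omega
    · exact ⟨i, hi, Or.inl h⟩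
    · omega
    · exact ⟨i, hi, Or.inr h⟩
  · rintro ⟨i, hi, ⟨h1, h2⟩ | ⟨h1, h2⟩⟩
    · exact graphS_adj_pair hi h1 h2
    · exact (graphS_adj_pair hi h1 h2).symm

/-- A graph whose edges outside the `k` vertices of `S` form a matching with at most `p` edges is
isomorphic to a subgraph of `graphS n k p`. -/
lemma exists_perm_graphS {n k p : ℕ} {G : SimpleGraph (Fin n)} {S : Finset (Fin n)} (hS : #S = k)
    (hpath : ∀ a b d, a ∉ S → b ∉ S → d ∉ S → G.Adj a b → G.Adj b d → a = d)
    (hmatch : ∀ q : ℕ, ∀ e : Fin q × Bool → Fin n, Function.Injective e → (∀ i, e i ∉ S) →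
      (∀ i j, matchingPattern q i j → G.Adj (e i) (e j)) → q ≤ p) :
    ∃ g : Equiv.Perm (Fin n), ∀ u v, G.Adj u v → (graphS n k p).Adj (g u) (g v) := by
  classical
  -- Each edge outside `S` is recorded by its smaller end; by `hpath` the partner is unique.
  set D := univ.filter (fun u => u ∉ S ∧ ∃ v, v ∉ S ∧ G.Adj u v ∧ u < v) with hD
  have hpart : ∀ u : D, ∃ v, v ∉ S ∧ G.Adj u v ∧ (u : Fin n) < v := fun u =>
    (mem_filter.1 u.2).2.2
  choose π hπS hπadj hπlt using hpart
  have hDS : ∀ u : D, (u : Fin n) ∉ S := fun u => (mem_filter.1 u.2).2.1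
  set q := #D with hq
  set en : Fin q ≃ D := (D.equivFinOfCardEq rfl).symm with hen
  set e : Fin q × Bool → Fin n := fun i => if i.2 then π (en i.1) else (en i.1 : Fin n) with he
  have heS : ∀ i, e i ∉ S := by
    rintro ⟨i, _ | _⟩
    · exact hDS _
    · exact hπS _
  have hπne : ∀ a b : D, π a ≠ b := by
    intro a b hab
    have h1 := hπadj a
    rw [hab] at h1
    have h2 := hpath a b (π b) (hDS a) (hDS b) (hπS b) h1 (hπadj b)
    have h3 := hπlt a
    have h4 := hπlt b
    rw [hab] at h3
    rw [← h2] at h4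
    exact absurd h4 h3.not_gt
  have heinj : Function.Injective e := by
    rintro ⟨i, _ | _⟩ ⟨j, _ | _⟩ hij
    · have : en i = en j := Subtype.ext hij
      rw [en.injective this]
    · exact absurd hij.symm (hπne _ _)
    · exact absurd hij (hπne _ _)
    · have h0 : π (en i) = π (en j) := hij
      have h1 := (hπadj (en j)).symm
      rw [← h0] at h1
      have := hpath _ _ _ (hDS _) (hπS _) (hDS _) (hπadj (en i)) h1
      rw [en.injective (Subtype.ext this)]
  have heP : ∀ i j, matchingPattern q i j → G.Adj (e i) (e j) := by
    rintro ⟨i, _ | _⟩ ⟨j, _ | _⟩ ⟨hij, hne⟩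
    · exact absurd rfl hne
    · obtain rfl : i = j := hij
      exact hπadj _
    · obtain rfl : i = j := hij
      exact (hπadj _).symm
    · exact absurd rfl hne
  have hqp : q ≤ p := hmatch q e heinj heS heP
  set es : Fin k → Fin n := fun j => ((S.equivFinOfCardEq hS).symm j : Fin n) with hes
  have hesS : ∀ j, es j ∈ S := fun j => ((S.equivFinOfCardEq hS).symm j).2
  have hessurj : ∀ u ∈ S, ∃ j, es j = u := fun u hu =>
    ⟨S.equivFinOfCardEq hS ⟨u, hu⟩, by simp [hes]⟩
  have hesinj : Function.Injective es := fun i j h =>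
    (S.equivFinOfCardEq hS).symm.injective (Subtype.ext h)
  set ψ : Fin k ⊕ (Fin q × Bool) → Fin n := Sum.elim es e with hψ
  have hψinj : Function.Injective ψ := by
    rw [hψ, Sum.elim_injective]
    exact ⟨hesinj, heinj, fun i j h => heS j (h ▸ hesS i)⟩
  have hkq : k + 2 * q ≤ n := by
    have := Fintype.card_le_of_injective ψ hψinj
    simp only [Fintype.card_sum, Fintype.card_prod, Fintype.card_fin, Fintype.card_bool] at this
    omega
  set φ : Fin k ⊕ (Fin q × Bool) → Fin n := Sum.elim (fun j => ⟨j, by omega⟩)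
    (fun i => ⟨k + 2 * i.1 + (if i.2 then 1 else 0), by split_ifs <;> omega⟩) with hφ
  have hφinj : Function.Injective φ := by
    rw [hφ, Sum.elim_injective]
    refine ⟨fun i j h => ?_, ?_, ?_⟩
    · simpa [Fin.ext_iff] using h
    · rintro ⟨i, _ | _⟩ ⟨j, _ | _⟩ hij
      · have h : k + 2 * (i : ℕ) + 0 = k + 2 * j + 0 := congrArg Fin.val hij
        rw [Fin.ext (by omega : (i : ℕ) = j)]
      · have h : k + 2 * (i : ℕ) + 0 = k + 2 * j + 1 := congrArg Fin.val hij
        omega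
      · have h : k + 2 * (i : ℕ) + 1 = k + 2 * j + 0 := congrArg Fin.val hij
        omega
      · have h : k + 2 * (i : ℕ) + 1 = k + 2 * j + 1 := congrArg Fin.val hij
        rw [Fin.ext (by omega : (i : ℕ) = j)]
    · intro i j h
      simp only [Fin.mk.injEq] at h
      omega
  obtain ⟨g, hg⟩ := exists_perm_of_injective hψinj hφinj
  have hgS : ∀ u ∈ S, (g u : ℕ) < k := by
    intro u hu
    obtain ⟨j, rfl⟩ := hessurj u hu
    have := hg (Sum.inl j)
    rw [show ψ (Sum.inl j) = es j from rfl] at this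
    rw [this]
    exact j.2
  have hgD : ∀ u v, u ∉ S → v ∉ S → G.Adj u v → u < v → (graphS n k p).Adj (g u) (g v) := by
    intro u v hu hv huv hlt
    have huD : u ∈ D := mem_filter.2 ⟨mem_univ u, hu, v, hv, huv, hlt⟩
    have hπv : π ⟨u, huD⟩ = v :=
      hpath _ _ _ (hπS _) hu hv (hπadj ⟨u, huD⟩).symm huv
    set i := en.symm ⟨u, huD⟩ with hi
    have h1 : ψ (Sum.inr (i, false)) = u := by simp [hψ, he, hi]
    have h2 : ψ (Sum.inr (i, true)) = v := by simp [hψ, he, hi, hπv]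
    have h3 := hg (Sum.inr (i, false))
    have h4 := hg (Sum.inr (i, true))
    rw [h1] at h3
    rw [h2] at h4
    refine graphS_adj_pair (i := i) (lt_of_lt_of_le i.2 hqp) ?_ ?_
    · rw [h3]; simp [hφ]
    · rw [h4]; simp [hφ]
  refine ⟨g, fun u v huv => ?_⟩
  by_cases hu : u ∈ S
  · exact graphS_adj_of_lt (fun h => huv.ne (g.injective h)) (hgS u hu)
  by_cases hv : v ∈ S
  · exact (graphS_adj_of_lt (fun h => huv.ne (g.injective h).symm) (hgS v hv)).symm
  rcases lt_or_gt_of_ne huv.ne with h | h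
  · exact hgD u v hu hv huv h
  · exact (hgD v u hv hu huv.symm h).symm

/-! ### Spectral lower bound, strict monotonicity, and extremal graphs. -/

/-- The test vector is the Perron vector of the complete bipartite graph between `S` and its
complement. Further edges only increase the quadratic form. -/
lemma sqrt_le_specRadius {α : Type*} [Fintype α] {G : SimpleGraph α} {S : Finset α}
    (hS : S.Nonempty) (hSn : #S < Fintype.card α) (hdom : ∀ s ∈ S, ∀ v, v ∉ S → G.Adj s v) :
    √((#S : ℝ) * (Fintype.card α - #S)) ≤ specRadius G := by
  classical
  set k : ℝ := (#S : ℝ) with hk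
  set r : ℝ := (Fintype.card α : ℝ) - #S with hr
  have hk0 : 0 < k := by rw [hk]; exact_mod_cast hS.card_pos
  have hr0 : 0 < r := by rw [hr]; exact sub_pos.2 (by exact_mod_cast hSn)
  have hcompl : (#Sᶜ : ℝ) = r := by rw [card_compl, Nat.cast_sub hSn.le]
  have hk2 := Real.sq_sqrt hk0.le
  have hr2 := Real.sq_sqrt hr0.le
  set y : α → ℝ := fun v => if v ∈ S then √r else √k with hy
  have hy0 : ∀ v, 0 ≤ y v := fun v => by
    simp only [hy]; split_ifs <;> exact Real.sqrt_nonneg _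
  have hyS : ∀ v ∈ S, y v = √r := fun v hv => if_pos hv
  have hyc : ∀ v ∈ Sᶜ, y v = √k := fun v hv => if_neg (mem_compl.1 hv)
  have hsq : ∑ v, y v ^ 2 = 2 * k * r := by
    have e1 : ∑ v ∈ S, y v ^ 2 = k * r := by
      rw [sum_congr rfl fun v hv => by rw [hyS v hv, hr2], sum_const, nsmul_eq_mul]
    have e2 : ∑ v ∈ Sᶜ, y v ^ 2 = r * k := by
      rw [sum_congr rfl fun v hv => by rw [hyc v hv, hk2], sum_const, nsmul_eq_mul, hcompl]
    rw [← sum_add_sum_compl S, e1, e2]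
    ring
  have h1 : ∀ v ∈ S, r * √k ≤ ∑ u, adjInd G v u * y u := by
    intro v hv
    calc r * √k = ∑ u ∈ Sᶜ, adjInd G v u * y u := by
          rw [sum_congr rfl fun u hu => by
            rw [hyc u hu, adjInd_of_adj (hdom v hv u (mem_compl.1 hu)), one_mul], sum_const,
            nsmul_eq_mul, hcompl]
      _ ≤ _ := sum_le_sum_of_subset_of_nonneg (subset_univ _)
          fun u _ _ => mul_nonneg (adjInd_nonneg G v u) (hy0 u)
  have h2 : ∀ v ∈ Sᶜ, k * √r ≤ ∑ u, adjInd G v u * y u := by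
    intro v hv
    calc k * √r = ∑ u ∈ S, adjInd G v u * y u := by
          rw [sum_congr rfl fun u hu => by
            rw [hyS u hu, adjInd_of_adj (hdom u hu v (mem_compl.1 hv)).symm, one_mul], sum_const,
            nsmul_eq_mul]
      _ ≤ _ := sum_le_sum_of_subset_of_nonneg (subset_univ _)
          fun u _ _ => mul_nonneg (adjInd_nonneg G v u) (hy0 u)
  have hq : 2 * k * r * (√k * √r) ≤ quadForm G y := by
    unfold quadForm
    rw [← sum_add_sum_compl S]
    have e1 : k * (√r * (r * √k)) ≤ ∑ v ∈ S, y v * ∑ u, adjInd G v u * y u := by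
      rw [hk, ← nsmul_eq_mul, ← sum_const]
      refine sum_le_sum fun v hv => ?_
      rw [hyS v hv]
      exact mul_le_mul_of_nonneg_left (h1 v hv) (Real.sqrt_nonneg _)
    have e2 : r * (√k * (k * √r)) ≤ ∑ v ∈ Sᶜ, y v * ∑ u, adjInd G v u * y u := by
      rw [← hcompl, ← nsmul_eq_mul, ← sum_const]
      refine sum_le_sum fun v hv => ?_
      rw [hyc v hv, hcompl]
      exact mul_le_mul_of_nonneg_left (h2 v hv) (Real.sqrt_nonneg _)
    linarith
  have h3 := hq.trans (quadForm_le G y)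
  rw [hsq] at h3
  rw [Real.sqrt_mul hk0.le]
  refine le_of_mul_le_mul_left ?_ (by positivity : 0 < 2 * k * r)
  linarith

/-- Strict monotonicity of the spectral radius, given a positive eigenvector of the subgraph. -/
lemma eq_of_le_of_specRadius_le {α : Type*} [Fintype α] {G H : SimpleGraph α} (hGH : G ≤ H)
    (hρ : specRadius H ≤ specRadius G) {x : α → ℝ} (hx : ∀ v, 0 < x v)
    (heig : ∀ v, ∑ u, adjInd G v u * x u = specRadius G * x v) : G = H := by
  have hquad : quadForm G x = specRadius G * ∑ u, x u ^ 2 := by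
    unfold quadForm
    simp only [heig, mul_sum]
    exact sum_congr rfl fun u _ => by ring
  have hmono : quadForm G x ≤ quadForm H x := by
    unfold quadForm
    gcongr with v _ u _
    · exact (hx v).le
    · exact (hx u).le
    · exact adjInd_mono hGH v u
  have h0 : 0 ≤ ∑ u, x u ^ 2 := sum_nonneg fun u _ => sq_nonneg _
  have hH := eigen_of_quadForm_eq H x (by nlinarith)
  refine le_antisymm hGH fun v u hvu => ?_
  have hle : ∑ w, adjInd H v w * x w ≤ ∑ w, adjInd G v w * x w := by
    rw [hH, heig]
    exact mul_le_mul_of_nonneg_right hρ (hx v).le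
  by_contra hcon
  refine absurd hle (not_le.2 (sum_lt_sum (fun w _ => ?_) ⟨u, mem_univ u, ?_⟩))
  · exact mul_le_mul_of_nonneg_right (adjInd_mono hGH v w) (hx w).le
  · rw [adjInd_of_adj hvu, adjInd_of_not_adj hcon]
    linarith [hx u]

lemma specRadius_le_spex {V : Type*} {n : ℕ} {F : SimpleGraph V} {G : SimpleGraph (Fin n)}
    (hG : F.Free G) : specRadius G ≤ spex n F := by
  refine le_csSup (Set.Finite.bddAbove ?_) ⟨G, hG, rfl⟩
  refine (Set.finite_range fun G : SimpleGraph (Fin n) => specRadius G).subset ?_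
  rintro x ⟨H, -, rfl⟩
  exact ⟨H, rfl⟩

lemma SPEX_nonempty {V : Type*} {n : ℕ} {F : SimpleGraph V} {G : SimpleGraph (Fin n)}
    (hG : F.Free G) : (SPEX n F).Nonempty := by
  have hfin : {x : ℝ | ∃ G : SimpleGraph (Fin n), F.Free G ∧ specRadius G = x}.Finite := by
    refine (Set.finite_range fun G : SimpleGraph (Fin n) => specRadius G).subset ?_
    rintro x ⟨H, -, rfl⟩
    exact ⟨H, rfl⟩
  have hne : {x : ℝ | ∃ G : SimpleGraph (Fin n), F.Free G ∧ specRadius G = x}.Nonempty :=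
    ⟨_, G, hG, rfl⟩
  obtain ⟨H, hH⟩ := hne.csSup_mem hfin
  exact ⟨H, hH⟩

/-- The extremal graphs of a rooted forest `F` whose splittings are known. -/
theorem SPEX_eq_isoClassS {V : Type*} [Fintype V] (F : SimpleGraph V) (d : V → ℕ) (par : V → V)
    (hpar : ∀ u v, F.Adj u v → (u = par v ∧ d u < d v) ∨ (v = par u ∧ d v < d u))
    (k : ℕ) (hk : 1 ≤ k) (hkℓ : k ≤ Fintype.card V) (hcover : Splits F (k + 1) (matchingPattern 0))
    (hpath : Splits F k pathPattern) (p : ℕ → ℕ)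
    (hmatch : ∀ n, (n - k) / 2 ≤ p n ∨ Splits F k (matchingPattern (p n + 1)))
    (hfree : ∀ n, F.Free (graphS n k (p n))) :
    ∃ N, ∀ n, N ≤ n → SPEX n F = isoClassS n k (p n) := by
  classical
  obtain ⟨N, K, η, hN⟩ := PerronData.exists_large k (Fintype.card V) hk hkℓ
  -- Beyond the spectral threshold `N`, this leaves room for all of `F` outside `k` vertices.
  refine ⟨N + k + Fintype.card V + 1, fun n hn => ?_⟩
  have : Nonempty (Fin n) := ⟨⟨0, by omega⟩⟩
  have key : ∀ G ∈ SPEX n F, Nonempty (G ≃g graphS n k (p n)) := by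
    rintro G ⟨hG, hGs⟩
    have hmax : ∀ H : SimpleGraph (Fin n), F.Free H → specRadius H ≤ specRadius G :=
      fun H hH => hGs ▸ specRadius_le_spex hH
    obtain ⟨x, hx0, hx1, hxz, hxe⟩ := exists_perron_vector G
    have hsqrt : √((k : ℝ) * (n - k)) ≤ specRadius G := by
      have hS : #(univ.filter fun v : Fin n => (v : ℕ) < k) = k := by
        rw [Fin.card_filter_val_lt]; omega
      have h1 := sqrt_le_specRadius (G := graphS n k (p n))
        (S := univ.filter fun v : Fin n => (v : ℕ) < k) (card_pos.1 (by omega))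
        (by rw [hS, Fintype.card_fin]; omega) (fun s hs v hv =>
          graphS_adj_of_lt (fun h => hv (h ▸ hs)) (mem_filter.1 hs).2)
      rw [hS, Fintype.card_fin] at h1
      exact h1.trans (hmax _ (hfree n))
    have hρ0 : 0 ≤ specRadius G := (Real.sqrt_nonneg _).trans hsqrt
    have hρ2 : (k : ℝ) * (n - k) ≤ specRadius G ^ 2 := (Real.sqrt_le_left hρ0).1 hsqrt
    have hsparse : IsSparse (Fintype.card V) G := by
      refine isSparse_of_degenerate _ _ fun W hW => ?_
      by_contra hcon
      push Not at hcon
      exact hG (isContained_of_minDegree F d par hpar G W hW hcon)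
    have hdata : PerronData G k (Fintype.card V) (specRadius G) x := by
      refine ⟨hk, hkℓ, hsparse, ?_, hx0, hx1, hxz, hρ0, by rwa [Fintype.card_fin], hxe⟩
      intro S B hS hSB
      by_contra hcon
      refine hG (hcover.isContained hS.ge hSB (not_lt.1 hcon) (fun i => i.1.elim0)
        (fun i => i.1.elim0) (fun i => i.1.elim0) (fun i => i.1.elim0))
    obtain ⟨⟨S, hSk, hdom⟩, hxpos⟩ := hdata.exists_dominating
      (by rw [Fintype.card_fin]; exact hN n _ (by omega) hρ0 hρ2)
      (fun v S B hv hSB hB => hmax _ (free_rejoin hG hv hSB hB))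
    have hSc : #Sᶜ = n - k := by rw [card_compl, hSk, Fintype.card_fin]
    have hemb : ∀ {κ : Type} [Finite κ] {P : κ → κ → Prop}, Splits F k P → ∀ e' : κ → Fin n,
        Function.Injective e' → (∀ i, e' i ∉ S) → ¬ ∀ i j, P i j → G.Adj (e' i) (e' j) := by
      intro κ _ P hP e' he' heS hadj
      exact hG (hP.isContained (B := Sᶜ) hSk.ge (fun s hs b hb => hdom s hs b (mem_compl.1 hb))
        (by omega) e' he' (fun i => mem_compl.2 (heS i)) hadj)
    obtain ⟨g, hg⟩ : ∃ g : Equiv.Perm (Fin n), ∀ u v, G.Adj u v →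
        (graphS n k (p n)).Adj (g u) (g v) := by
      refine exists_perm_graphS hSk ?_ ?_
      · intro a b d ha hb hd hab hbd
        by_contra had
        refine hemb hpath ![a, b, d] ?_ ?_ ?_
        · intro i j hij
          fin_cases i <;> fin_cases j <;> first
            | rfl
            | exact absurd hij hab.ne
            | exact absurd hij hab.ne'
            | exact absurd hij hbd.ne
            | exact absurd hij hbd.ne'
            | exact absurd hij had
            | exact absurd hij.symm had
        · intro i
          fin_cases i <;> assumption
        · rintro i j ⟨hij, h1⟩
          fin_cases i <;> fin_cases j <;> first
            | exact hab
            | exact hab.symm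
            | exact hbd
            | exact hbd.symm
            | exact absurd rfl hij
            | exact absurd h1 (by decide)
      · intro q e he heS hadj
        rcases hmatch n with h1 | h1
        · have h2 : #(univ.image e) ≤ #Sᶜ := card_le_card fun v hv => by
            obtain ⟨i, -, rfl⟩ := mem_image.1 hv
            exact mem_compl.2 (heS i)
          rw [card_image_of_injective _ he, hSc, card_univ, Fintype.card_prod, Fintype.card_fin,
            Fintype.card_bool] at h2
          omega
        · by_contra hcon
          refine hemb h1 (fun i => e (Fin.castLE (by omega) i.1, i.2)) ?_ (fun i => heS _) ?_
          · rintro ⟨i, a⟩ ⟨j, b⟩ hij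
            have := he hij
            simp only [Prod.mk.injEq, Fin.castLE_inj] at this
            rw [this.1, this.2]
          · rintro ⟨i, a⟩ ⟨j, b⟩ ⟨h3, h4⟩
            refine hadj _ _ ⟨?_, h4⟩
            simpa using h3
    have hiso : ((graphS n k (p n)).comap g) ≃g graphS n k (p n) := SimpleGraph.Iso.comap g _
    have hGH : G = (graphS n k (p n)).comap g := by
      refine eq_of_le_of_specRadius_le (fun u v huv => hg u v huv) ?_ hxpos hxe
      exact hmax _ ((SimpleGraph.free_congr_right hiso).2 (hfree n))
    exact ⟨hGH ▸ hiso⟩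
  ext H
  refine ⟨fun hH => key H hH, fun ⟨hH⟩ => ?_⟩
  -- Some extremal graph exists, it lies in the isomorphism class, and extremality passes along
  -- isomorphisms.
  obtain ⟨G, hG⟩ := SPEX_nonempty (hfree n)
  obtain ⟨e⟩ := key G hG
  have e' : H ≃g G := hH.trans e.symm
  exact ⟨(SimpleGraph.free_congr_right e').2 hG.1, (specRadius_congr e').trans hG.2⟩

/-! ### Counting positions on a leg. -/

section Counting

lemma card_filter_even (m : ℕ) [DecidablePred fun j : ℕ => Even j] : #{j ∈ Icc 1 m | Even j} = m / 2 := by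
  induction m with
  | zero => simp
  | succ m ih =>
    rw [← insert_Icc_right_eq_Icc_add_one (by omega), filter_insert]
    split_ifs with h
    · rw [card_insert_of_notMem (by simp), ih]
      obtain ⟨a, ha⟩ := h
      omega
    · rw [ih]
      rw [Nat.not_even_iff] at h
      omega

lemma card_filter_odd (m : ℕ) [DecidablePred fun j : ℕ => Odd j] : #{j ∈ Icc 1 m | Odd j} = (m + 1) / 2 := by
  have h1 := card_filter_add_card_filter_not (s := Icc 1 m) (fun j => Even j)
  rw [card_filter_even, Nat.card_Icc] at h1
  have h2 : #{j ∈ Icc 1 m | Odd j} = #{j ∈ Icc 1 m | ¬ Even j} :=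
    congrArg card (filter_congr fun j _ => Nat.not_even_iff_odd.symm)
  omega

/-- If a set meets `t` consecutive disjoint pairs, then it has at least `t` elements there. -/
lemma le_card_of_pairs (Q : ℕ → Prop) [DecidablePred Q] (a t : ℕ)
    (h : ∀ s < t, Q (a + 2 * s) ∨ Q (a + 2 * s + 1)) : t ≤ #{j ∈ Ico a (a + 2 * t) | Q j} := by
  induction t with
  | zero => simp
  | succ t ih =>
    have h1 := ih fun s hs => h s (by omega)
    have hlt : {j ∈ Ico a (a + 2 * t) | Q j} ⊂ {j ∈ Ico a (a + 2 * (t + 1)) | Q j} := by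
      rw [ssubset_iff_of_subset]
      · rcases h t (by omega) with h2 | h2
        · exact ⟨a + 2 * t, by simp [h2], by simp⟩
        · exact ⟨a + 2 * t + 1, by simp [h2]; omega, by simp⟩
      · intro j hj
        simp only [mem_filter, mem_Ico] at hj ⊢
        exact ⟨⟨hj.1.1, by omega⟩, hj.2⟩
    have := card_lt_card hlt
    omega

lemma le_card_Icc_of_pairs (Q : ℕ → Prop) [DecidablePred Q] {a t m : ℕ} (ha : 1 ≤ a)
    (hm : a + 2 * t ≤ m + 1) (h : ∀ s < t, Q (a + 2 * s) ∨ Q (a + 2 * s + 1)) :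
    t ≤ #{j ∈ Icc 1 m | Q j} := by
  refine (le_card_of_pairs Q a t h).trans (card_le_card fun j hj => ?_)
  simp only [mem_filter, mem_Ico, mem_Icc] at hj ⊢
  exact ⟨⟨by omega, by omega⟩, hj.2⟩

/-- Here the pairs start at position `0`, the center; it belongs to all legs and is charged
separately. -/
lemma le_add_card_Icc_of_pairs (Q : ℕ → Prop) [DecidablePred Q] {t m : ℕ}
    (hm : 2 * t ≤ m + 1) (h : ∀ s < t, Q (2 * s) ∨ Q (2 * s + 1)) :
    t ≤ (if Q 0 then 1 else 0) + #{j ∈ Icc 1 m | Q j} := by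
  have h1 := le_card_of_pairs Q 0 t (by simpa using h)
  have hsub : {j ∈ Ico 0 (0 + 2 * t) | Q j} ⊆ (if Q 0 then {0} else ∅) ∪ {j ∈ Icc 1 m | Q j} := by
    intro j hj
    simp only [mem_filter, mem_Ico] at hj
    rw [mem_union]
    rcases Nat.eq_zero_or_pos j with rfl | hj0
    · left; simp [hj.2]
    · right
      simp only [mem_filter, mem_Icc]
      exact ⟨⟨hj0, by omega⟩, hj.2⟩
  have h2 := (card_le_card hsub).trans (card_union_le _ _)
  split_ifs at h2 ⊢
  · rw [card_singleton] at h2; omega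
  · rw [card_empty] at h2; omega

end Counting

/-! ### Vertex sets of a spider in leg coordinates. -/

namespace LegSystem

variable {V ι : Type*} {F : SimpleGraph V} {c : V} {m : ι → ℕ} {g : ι → ℕ → V}

lemma eq_or_of_eq (h : LegSystem F c m g) {i i' j j'} (hj : j ≤ m i) (hj' : j' ≤ m i')
    (he : g i j = g i' j') : j = j' ∧ (j = 0 ∨ i = i') := by
  rcases Nat.eq_zero_or_pos j with rfl | h1 <;> rcases Nat.eq_zero_or_pos j' with rfl | h1'
  · exact ⟨rfl, Or.inl rfl⟩
  · rw [h.zero] at he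
    exact absurd he.symm (h.ne h1' hj')
  · rw [h.zero] at he
    exact absurd he (h.ne h1 hj)
  · obtain ⟨h2, h3⟩ := h.inj h1 hj h1' hj' he
    exact ⟨h3, Or.inr h2⟩

lemma ne_of_ne (h : LegSystem F c m g) {i i' j j'} (hj : j ≤ m i) (hj' : j' ≤ m i')
    (hne : j ≠ j') : g i j ≠ g i' j' := fun he => hne (h.eq_or_of_eq hj hj' he).1

lemma exists_eq (h : LegSystem F c m g) [Nonempty ι] (v : V) : ∃ i j, j ≤ m i ∧ v = g i j := by
  rcases h.surj v with rfl | ⟨i, j, -, h2, h3⟩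
  · exact ⟨Classical.arbitrary ι, 0, Nat.zero_le _, (h.zero _).symm⟩
  · exact ⟨i, j, h2, h3⟩

/-- The spider is rooted at its center. Coordinates are ambiguous only there, where the depth is `0`
in any case. -/
lemma exists_parent (h : LegSystem F c m g) [Nonempty ι] : ∃ (d : V → ℕ) (par : V → V),
    ∀ u v, F.Adj u v → (u = par v ∧ d u < d v) ∨ (v = par u ∧ d v < d u) := by
  choose I J hJ hv using h.exists_eq
  have hd : ∀ {i j}, j ≤ m i → J (g i j) = j := fun {i j} hj =>
    ((h.eq_or_of_eq hj (hJ _) (hv _)).1).symm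
  have hpar : ∀ {i j}, j < m i → g (I (g i (j + 1))) (J (g i (j + 1)) - 1) = g i j := by
    intro i j hj
    obtain ⟨-, h1 | h1⟩ := h.eq_or_of_eq hj (hJ _) (hv (g i (j + 1)))
    · omega
    · rw [hd hj, ← h1, Nat.succ_sub_one]
  refine ⟨J, fun v => g (I v) (J v - 1), fun u v huv => ?_⟩
  obtain ⟨i, j, hj, ⟨rfl, rfl⟩ | ⟨rfl, rfl⟩⟩ := h.edge huv
  · left
    refine ⟨(hpar hj).symm, ?_⟩
    rw [hd hj.le, hd hj]
    omega
  · right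
    refine ⟨(hpar hj).symm, ?_⟩
    rw [hd hj.le, hd hj]
    omega

variable [Fintype ι]

open Classical in
lemma card_eq (h : LegSystem F c m g) (T : Finset V) :
    #T = (if c ∈ T then 1 else 0) + ∑ i, #{j ∈ Icc 1 (m i) | g i j ∈ T} := by
  have h1 : #(T.erase c) = ∑ i, #{j ∈ Icc 1 (m i) | g i j ∈ T} := by
    rw [← card_sigma]
    symm
    refine card_bij (fun x _ => g x.1 x.2) ?_ ?_ ?_
    · rintro ⟨i, j⟩ hx
      simp only [mem_sigma, mem_univ, true_and, mem_filter, mem_Icc] at hx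
      exact mem_erase.2 ⟨h.ne hx.1.1 hx.1.2, hx.2⟩
    · rintro ⟨i, j⟩ hx ⟨i', j'⟩ hx' he
      simp only [mem_sigma, mem_univ, true_and, mem_filter, mem_Icc] at hx hx'
      obtain ⟨rfl, rfl⟩ := h.inj hx.1.1 hx.1.2 hx'.1.1 hx'.1.2 he
      rfl
    · intro v hv
      obtain ⟨hvc, hvT⟩ := mem_erase.1 hv
      obtain rfl | ⟨i, j, h1, h2, rfl⟩ := h.surj v
      · exact absurd rfl hvc
      · exact ⟨⟨i, j⟩, by simp [h1, h2, hvT], rfl⟩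
  rw [← h1]
  split_ifs with hc
  · rw [card_erase_of_mem hc]
    have := card_pos.2 ⟨c, hc⟩
    omega
  · rw [erase_eq_of_notMem hc, zero_add]

lemma card_vertices [Fintype V] (h : LegSystem F c m g) : Fintype.card V = 1 + ∑ i, m i := by
  classical
  rw [← card_univ, h.card_eq]
  simp

open Classical in
/-- A splitting given by leg coordinates. -/
lemma splits [Fintype V] (h : LegSystem F c m g) [Nonempty ι] {κ : Type*} {P : κ → κ → Prop}
    {k b : ℕ} (Q : ι → ℕ → Prop) (hQ0 : ∀ i, Q i 0 ↔ b = 1)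
    (w : ι → ℕ) (hw : ∀ i, #{j ∈ Icc 1 (m i) | Q i j} ≤ w i)
    (hcount : b + ∑ i, w i ≤ k)
    (hind : ∀ i j, j < m i → ¬ (Q i j ∧ Q i (j + 1)))
    (e : κ → V) (he : Function.Injective e)
    (hrest : ∀ i j, j < m i → ¬ Q i j → ¬ Q i (j + 1) →
      ∃ a b, P a b ∧ P b a ∧ g i j = e a ∧ g i (j + 1) = e b) : Splits F k P := by
  set T : Finset V := univ.filter fun v => ∃ i j, j ≤ m i ∧ v = g i j ∧ Q i j with hT
  -- The center is position `0` of every leg; `hQ0` makes all legs agree on whether it is removed.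
  have hmem : ∀ {i j}, j ≤ m i → (g i j ∈ T ↔ Q i j) := by
    intro i j hj
    simp only [hT, mem_filter, mem_univ, true_and]
    constructor
    · rintro ⟨i', j', hj', hv, hQ⟩
      obtain ⟨rfl, rfl | rfl⟩ := h.eq_or_of_eq hj hj' hv
      · exact (hQ0 i).2 ((hQ0 i').1 hQ)
      · exact hQ
    · exact fun hQ => ⟨i, j, hj, rfl, hQ⟩
  refine ⟨T, e, ?_, ?_, he, ?_⟩
  · rw [h.card_eq]
    refine le_trans (add_le_add ?_ (sum_le_sum fun i _ => ?_)) hcount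
    · split_ifs with hc
      · rw [← h.zero (Classical.arbitrary ι), hmem (Nat.zero_le _), hQ0] at hc
        exact hc.ge
      · exact Nat.zero_le _
    · refine le_trans (le_of_eq (congrArg card (filter_congr fun j hj => ?_))) (hw i)
      exact hmem (mem_Icc.1 hj).2
  · intro u hu v hv huv
    obtain ⟨i, j, hj, ⟨rfl, rfl⟩ | ⟨rfl, rfl⟩⟩ := h.edge huv
    · exact hind i j hj ⟨(hmem hj.le).1 hu, (hmem hj).1 hv⟩
    · exact hind i j hj ⟨(hmem hj.le).1 hv, (hmem hj).1 hu⟩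
  · intro u v hu hv huv
    obtain ⟨i, j, hj, ⟨rfl, rfl⟩ | ⟨rfl, rfl⟩⟩ := h.edge huv
    · rw [hmem hj.le] at hu
      rw [hmem hj] at hv
      obtain ⟨a, b, h1, -, h2, h3⟩ := hrest i j hj hu hv
      exact ⟨a, b, h1, h2, h3⟩
    · rw [hmem hj] at hu
      rw [hmem hj.le] at hv
      obtain ⟨a, b, -, h1, h2, h3⟩ := hrest i j hj hv hu
      exact ⟨b, a, h1, h3, h2⟩

end LegSystem

/-! ### Explicit splittings of a spider. -/

namespace LegSystem

lemma injective_vec_three {V : Type*} {a b d : V} (hab : a ≠ b) (hbd : b ≠ d) (had : a ≠ d) :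
    Function.Injective ![a, b, d] := by
  intro i j hij
  fin_cases i <;> fin_cases j <;> first
    | rfl
    | exact absurd hij hab
    | exact absurd hij hab.symm
    | exact absurd hij hbd
    | exact absurd hij hbd.symm
    | exact absurd hij had
    | exact absurd hij had.symm

lemma sum_tsub_ite {ι : Type*} [Fintype ι] (w : ι → ℕ) (s : Finset ι) [DecidableEq ι] (hs : ∀ i ∈ s, 1 ≤ w i) :
    ∑ i, (if i ∈ s then w i - 1 else w i) + #s = ∑ i, w i := by
  have h1 : #s = ∑ i, if i ∈ s then 1 else 0 := by simp
  rw [h1, ← sum_add_distrib]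
  refine sum_congr rfl fun i _ => ?_
  split_ifs with hi
  · have := hs i hi; omega
  · rfl

lemma card_filter_ne_le (Q : ℕ → Prop) [DecidablePred Q] (a t w : ℕ)
    (hw : #{j ∈ Icc 1 a | Q j} ≤ w) (ht : t ∈ Icc 1 a) (hQ : Q t) :
    #{j ∈ Icc 1 a | Q j ∧ j ≠ t} ≤ w - 1 := by
  have h1 : {j ∈ Icc 1 a | Q j ∧ j ≠ t} = {j ∈ Icc 1 a | Q j}.erase t := by
    ext j; simp only [mem_filter, mem_erase]; tauto
  rw [h1, card_erase_of_mem (mem_filter.2 ⟨ht, hQ⟩)]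
  exact Nat.sub_le_sub_right hw 1

variable {V ι : Type*} [Fintype V] [Fintype ι] [Nonempty ι] {F : SimpleGraph V} {c : V}
  {m : ι → ℕ} {g : ι → ℕ → V}

/-- The even positions form an independent cover. -/
lemma splits_even (h : LegSystem F c m g) :
    Splits F ((∑ i, m i / 2) + 1) (matchingPattern 0) := by
  classical
  refine h.splits (b := 1) (fun _ j => Even j) (by simp) (fun i => m i / 2)
    (fun i => by rw [card_filter_even]) (by omega) ?_ (fun i => i.1.elim0) (fun i => i.1.elim0) ?_
  · rintro i j - ⟨h1, h2⟩
    grind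
  · intro i j _ h1 h2
    grind

/-- The odd positions form an independent cover. -/
lemma splits_odd (h : LegSystem F c m g) :
    Splits F (∑ i, (m i + 1) / 2) (matchingPattern 0) := by
  classical
  refine h.splits (b := 0) (fun _ j => Odd j) (by simp) (fun i => (m i + 1) / 2)
    (fun i => by rw [card_filter_odd]) (by omega) ?_ (fun i => i.1.elim0) (fun i => i.1.elim0) ?_
  · rintro i j - ⟨h1, h2⟩
    grind
  · intro i j _ h1 h2
    grind

/-- Dropping the last even position of a leg leaves at most a path on three vertices. -/
lemma splits_path_even (h : LegSystem F c m g) {i₀ : ι} (hi₀ : 2 ≤ m i₀) :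
    Splits F (∑ i, m i / 2) pathPattern := by
  classical
  set t := 2 * (m i₀ / 2) with ht
  have hsum := sum_tsub_ite (fun i => m i / 2) {i₀} (by intro i hi; simp at hi; subst hi; omega)
  rw [card_singleton] at hsum
  set X := if t < m i₀ then g i₀ (t + 1) else g i₀ (t - 2) with hX
  have hXne : ∀ j, j ≤ m i₀ → j = t ∨ j = t - 1 → g i₀ j ≠ X := by
    intro j hj hjt
    rw [hX]
    split_ifs with hlt
    · exact h.ne_of_ne hj hlt (by omega)
    · exact h.ne_of_ne hj (by omega) (by omega)
  refine h.splits (b := 1) (fun i j => Even j ∧ (i = i₀ → j ≠ t)) (by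
      intro i; simp only [iff_true]; exact ⟨Even.zero, fun _ => by omega⟩)
    (fun i => if i ∈ ({i₀} : Finset ι) then m i / 2 - 1 else m i / 2) ?_ (by omega) ?_
    ![g i₀ (t - 1), g i₀ t, X]
    (injective_vec_three (h.ne_of_ne (by omega) (by omega) (by omega))
      (hXne _ (by omega) (Or.inl rfl)) (hXne _ (by omega) (Or.inr rfl))) ?_
  · intro i
    by_cases hi : i = i₀
    · subst hi
      simp only [mem_singleton, if_true, forall_const]
      exact card_filter_ne_le _ _ _ _ (card_filter_even _).le (mem_Icc.2 ⟨by omega, by omega⟩)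
        ⟨m i / 2, by omega⟩
    · simp only [mem_singleton, hi, if_false, false_implies, and_true]
      exact (card_filter_even _).le
  · rintro i j - ⟨⟨h1, -⟩, ⟨h2, -⟩⟩
    grind
  · intro i j hj h1 h2
    have hi : i = i₀ := by grind
    subst hi
    have hjt : j = t ∨ j + 1 = t := by grind
    rcases hjt with rfl | hjt
    · exact ⟨1, 2, by simp [pathPattern], by simp [pathPattern], rfl, by simp [hX, hj]⟩
    · refine ⟨0, 1, by simp [pathPattern], by simp [pathPattern], ?_, ?_⟩
      · rw [show j = t - 1 by omega]; rfl
      · rw [hjt]; rfl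

/-- Dropping the first position of a leg from the odd positions leaves a path on three vertices. -/
lemma splits_path_odd (h : LegSystem F c m g) {i₀ : ι} (hi₀ : 2 ≤ m i₀) :
    Splits F (∑ i, (m i + 1) / 2 - 1) pathPattern := by
  classical
  have hsum := sum_tsub_ite (fun i => (m i + 1) / 2) {i₀}
    (by intro i hi; simp at hi; subst hi; omega)
  rw [card_singleton] at hsum
  refine h.splits (b := 0) (fun i j => Odd j ∧ (i = i₀ → j ≠ 1)) (by simp)
    (fun i => if i ∈ ({i₀} : Finset ι) then (m i + 1) / 2 - 1 else (m i + 1) / 2) ?_ (by omega) ?_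
    ![g i₀ 0, g i₀ 1, g i₀ 2]
    (injective_vec_three (h.ne_of_ne (by omega) (by omega) (by omega))
      (h.ne_of_ne (by omega) (by omega) (by omega))
      (h.ne_of_ne (by omega) (by omega) (by omega))) ?_
  · intro i
    by_cases hi : i = i₀
    · subst hi
      simp only [mem_singleton, if_true, forall_const]
      exact card_filter_ne_le _ _ _ _ (card_filter_odd _).le (mem_Icc.2 ⟨by omega, by omega⟩)
        odd_one
    · simp only [mem_singleton, hi, if_false, false_implies, and_true]
      exact (card_filter_odd _).le
  · rintro i j - ⟨⟨h1, -⟩, ⟨h2, -⟩⟩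
    grind
  · intro i j hj h1 h2
    have hi : i = i₀ := by grind
    subst hi
    have hjt : j = 0 ∨ j = 1 := by grind
    rcases hjt with rfl | rfl
    · exact ⟨0, 1, by simp [pathPattern], by simp [pathPattern], rfl, rfl⟩
    · exact ⟨1, 2, by simp [pathPattern], by simp [pathPattern], rfl, rfl⟩

/-- Dropping the leaves of `q` legs of even length from the even positions leaves `q` disjoint
edges. -/
lemma splits_matching_even (h : LegSystem F c m g) {q : ℕ} (I : Fin q → ι)
    (hI : Function.Injective I) (hIe : ∀ a, Even (m (I a))) :
    Splits F (∑ i, m i / 2 + 1 - q) (matchingPattern q) := by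
  classical
  have hm2 : ∀ a, 2 ≤ m (I a) := by
    intro a
    have := h.pos (I a)
    have := hIe a
    grind
  have hmem : ∀ i, i ∈ univ.image I ↔ ∃ a, I a = i := by simp
  have hsum := sum_tsub_ite (fun i => m i / 2) (univ.image I) (by
    intro i hi
    obtain ⟨a, rfl⟩ := (hmem i).1 hi
    have := hm2 a
    omega)
  rw [card_image_of_injective _ hI, card_univ, Fintype.card_fin] at hsum
  refine h.splits (b := 1) (fun i j => Even j ∧ (i ∈ univ.image I → j ≠ m i)) (by
      intro i; simp only [iff_true]
      exact ⟨Even.zero, fun _ => by have := h.pos i; omega⟩)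
    (fun i => if i ∈ univ.image I then m i / 2 - 1 else m i / 2) ?_ (by omega) ?_
    (fun a => if a.2 then g (I a.1) (m (I a.1)) else g (I a.1) (m (I a.1) - 1)) ?_ ?_
  · intro i
    by_cases hi : i ∈ univ.image I
    · simp only [hi, if_true, forall_const]
      obtain ⟨a, rfl⟩ := (hmem i).1 hi
      exact card_filter_ne_le _ _ _ _ (card_filter_even _).le
        (mem_Icc.2 ⟨h.pos _, le_rfl⟩) (hIe a)
    · simp only [hi, if_false, false_implies, and_true]
      exact (card_filter_even _).le
  · rintro i j - ⟨⟨h1, -⟩, ⟨h2, -⟩⟩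
    grind
  · have key : ∀ (a b : Fin q) (x y : ℕ), x ≤ 1 → y ≤ 1 →
        g (I a) (m (I a) - x) = g (I b) (m (I b) - y) → a = b ∧ x = y := by
      intro a b x y hx hy he
      have := hm2 a
      have := hm2 b
      obtain ⟨h1, h2⟩ := h.inj (by omega) (by omega) (by omega) (by omega) he
      obtain rfl := hI h1
      exact ⟨rfl, by omega⟩
    rintro ⟨a, _ | _⟩ ⟨b, _ | _⟩ hab
    · rw [(key a b 1 1 le_rfl le_rfl hab).1]
    · have := (key a b 1 0 le_rfl (by omega) hab).2
      omega
    · have := (key a b 0 1 (by omega) le_rfl hab).2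
      omega
    · rw [(key a b 0 0 (by omega) (by omega) hab).1]
  · intro i j hj h1 h2
    have hi : i ∈ univ.image I := by grind
    obtain ⟨a, rfl⟩ := (hmem i).1 hi
    have hjm : j + 1 = m (I a) := by
      have := hIe a
      grind
    refine ⟨(a, false), (a, true), ⟨rfl, by simp⟩, ⟨rfl, by simp⟩, ?_, ?_⟩
    · rw [show j = m (I a) - 1 by omega]; rfl
    · rw [hjm]; rfl

/-- A leg of odd length at least five can be split so that two disjoint edges remain. -/
lemma splits_matching_two (h : LegSystem F c m g) {i₀ : ι} (hi₀ : 5 ≤ m i₀) (hodd : Odd (m i₀)) :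
    Splits F (∑ i, m i / 2) (matchingPattern 2) := by
  classical
  have hsum := sum_tsub_ite (fun i => m i / 2) {i₀} (by intro i hi; simp at hi; subst hi; omega)
  rw [card_singleton] at hsum
  -- On this leg the center and the odd positions `3, …, m i₀ - 2` are removed. The edges left,
  -- `1`–`2` and the one at the leaf, are disjoint because `m i₀ ≥ 5`.
  set pos : Fin 2 × Bool → ℕ := fun a =>
    if a.1 = 0 then (if a.2 then 2 else 1) else (if a.2 then m i₀ else m i₀ - 1) with hpos
  have hposle : ∀ a, pos a ≤ m i₀ := by
    intro a; simp only [hpos]; split_ifs <;> omega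
  have hposinj : Function.Injective pos := by
    rintro ⟨a, x⟩ ⟨b, y⟩ hab
    simp only [hpos] at hab
    fin_cases a <;> fin_cases b <;> cases x <;> cases y <;> first
      | rfl
      | (simp at hab; done)
      | (simp at hab; omega)
  refine h.splits (b := 1)
    (fun i j => if i = i₀ then (j = 0 ∨ ((Odd j ∧ j ≠ 1) ∧ j ≠ m i₀)) else Even j) (by
      intro i; simp only [iff_true]
      split_ifs
      · exact Or.inl trivial
      · exact Even.zero)
    (fun i => if i ∈ ({i₀} : Finset ι) then m i / 2 - 1 else m i / 2) ?_ (by omega) ?_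
    (fun a => g i₀ (pos a)) ?_ ?_
  · intro i
    by_cases hi : i = i₀
    · subst hi
      simp only [mem_singleton, if_true]
      have e1 : #{j ∈ Icc 1 (m i) | (Odd j ∧ j ≠ 1) ∧ j ≠ m i} ≤ (m i + 1) / 2 - 1 - 1 :=
        card_filter_ne_le _ _ _ _
          (card_filter_ne_le _ _ _ _ (card_filter_odd _).le (mem_Icc.2 ⟨by omega, by omega⟩)
            odd_one) (mem_Icc.2 ⟨by omega, le_rfl⟩) ⟨hodd, by omega⟩
      refine le_trans (card_le_card fun j hj => ?_) (e1.trans (by omega))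
      simp only [mem_filter, mem_Icc] at hj ⊢
      refine ⟨hj.1, hj.2.resolve_left (by omega)⟩
    · simp only [mem_singleton, hi, if_false]
      exact (card_filter_even _).le
  · rintro i j - ⟨h1, h2⟩
    grind
  · intro a b hab
    exact hposinj (h.eq_or_of_eq (hposle a) (hposle b) hab).1
  · intro i j hj h1 h2
    have hi : i = i₀ := by grind
    subst hi
    rw [if_pos rfl] at h1 h2
    have hjt : j = 1 ∨ j + 1 = m i := by grind
    rcases hjt with rfl | hjt
    · exact ⟨(0, false), (0, true), ⟨rfl, by simp⟩, ⟨rfl, by simp⟩, by simp [hpos], by simp [hpos]⟩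
    · refine ⟨(1, false), (1, true), ⟨rfl, by simp⟩, ⟨rfl, by simp⟩, ?_, ?_⟩
      · rw [show j = m i - 1 by omega]; simp [hpos]
      · rw [hjt]; simp [hpos]

/-- If all legs have length three, except for at most one of length one, then removing the first
vertices of the long legs leaves one edge per leg. -/
lemma splits_matching_legs (h : LegSystem F c m g) (hm : ∀ i, m i = 1 ∨ m i = 3)
    (hone : ∀ i i', m i = 1 → m i' = 1 → i = i') :
    Splits F (∑ i, m i / 2) (matchingPattern (Fintype.card ι)) := by
  classical
  set E := (Fintype.equivFin ι).symm with hE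
  -- The edges kept are the last edges of the legs. Only legs of length one reach the center, so
  -- having at most one of them makes these edges disjoint.
  have hinj : ∀ i i' j j', j ≤ m i → j' ≤ m i' → (m i = 1 → j ≤ 1) → (m i = 3 → 2 ≤ j) →
      (m i' = 1 → j' ≤ 1) → (m i' = 3 → 2 ≤ j') → g i j = g i' j' → i = i' ∧ j = j' := by
    intro i i' j j' hj hj' a1 a2 a3 a4 he
    obtain ⟨h1, h2 | h2⟩ := h.eq_or_of_eq hj hj' he
    · refine ⟨hone i i' ?_ ?_, h1⟩
      · rcases hm i with h3 | h3
        · exact h3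
        · have := a2 h3; omega
      · rcases hm i' with h3 | h3
        · exact h3
        · have := a4 h3; omega
    · exact ⟨h2, h1⟩
  refine h.splits (b := 0) (fun i j => m i = 3 ∧ j = 1) (by simp) (fun i => m i / 2) ?_
    (by omega) ?_
    (fun a => g (E a.1) (if a.2 then m (E a.1) else m (E a.1) - 1)) ?_ ?_
  · intro i
    rcases hm i with hi | hi
    · simp [hi]
    · refine (card_le_card (t := {1}) fun j hj => ?_).trans (by simp [hi])
      simp only [mem_filter] at hj
      simp [hj.2.2]
  · rintro i j - ⟨⟨-, h1⟩, ⟨-, h2⟩⟩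
    omega
  · rintro ⟨a, x⟩ ⟨b, y⟩ hab
    obtain ⟨h1, h2⟩ := hinj _ _ _ _ (by split_ifs <;> omega) (by split_ifs <;> omega)
      (by intro; split_ifs <;> omega) (by intro; split_ifs <;> omega)
      (by intro; split_ifs <;> omega) (by intro; split_ifs <;> omega) hab
    obtain rfl := E.injective h1
    have := h.pos (E a)
    cases x <;> cases y <;> first
      | rfl
      | (simp at h2; omega)
  · intro i j hj h1 h2
    have hjm : j + 1 = m i := by
      have := hm i
      grind
    refine ⟨(E.symm i, false), (E.symm i, true), ⟨rfl, by simp⟩, ⟨rfl, by simp⟩, ?_, ?_⟩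
    · simp [← hjm]
    · simp [← hjm]

end LegSystem

/-! ### The graphs `S_{n,k}^p` are `F`-free. -/

namespace LegSystem

variable {V ι : Type*} [Fintype V] [Fintype ι] {F : SimpleGraph V} {c : V}
  {m : ι → ℕ} {g : ι → ℕ → V}

omit [Fintype ι] in
/-- `F` is not contained in `graphS n k p` if no set `T` of at most `k` vertices leaves only edges
that can be labelled injectively by numbers below `p` attached to their end points. -/
lemma free_graphS (h : LegSystem F c m g) {n k p : ℕ}
    (hT : ∀ (T : Finset V) (X : V → ℕ), #T ≤ k →
      (∀ i j, j < m i → g i j ∉ T → g i (j + 1) ∉ T →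
        X (g i j) = X (g i (j + 1)) ∧ X (g i j) < p) →
      (∀ i j i' j', j < m i → j' < m i' → g i j ∉ T → g i (j + 1) ∉ T → g i' j' ∉ T →
        g i' (j' + 1) ∉ T → X (g i j) = X (g i' j') → i = i' ∧ j = j') → False) :
    F.Free (graphS n k p) := by
  classical
  rintro ⟨f⟩
  have hinj : Function.Injective f := f.injective
  set T := univ.filter (fun v => (f v : ℕ) < k) with hTd
  have hmem : ∀ v, v ∉ T ↔ k ≤ (f v : ℕ) := by intro v; simp [hTd]
  have hedge : ∀ i j, j < m i → g i j ∉ T → g i (j + 1) ∉ T → ∃ a < p,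
      ((f (g i j) : ℕ) = k + 2 * a ∧ (f (g i (j + 1)) : ℕ) = k + 2 * a + 1) ∨
      ((f (g i (j + 1)) : ℕ) = k + 2 * a ∧ (f (g i j) : ℕ) = k + 2 * a + 1) := by
    intro i j hj h1 h2
    exact (graphS_adj_iff ((hmem _).1 h1) ((hmem _).1 h2)).1 (f.toHom.map_adj (h.adj hj))
  -- The two ends `k + 2a` and `k + 2a + 1` of an added edge share the label `a`.
  refine hT T (fun v => ((f v : ℕ) - k) / 2) ?_ ?_ ?_
  · calc #T ≤ #(range k) := by
          refine card_le_card_of_injOn (fun v => (f v : ℕ)) ?_ ?_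
          · intro v hv
            simpa [hTd] using hv
          · intro u _ v _ huv
            exact hinj (Fin.ext huv)
      _ = k := card_range k
  · intro i j hj h1 h2
    obtain ⟨a, ha, h3 | h3⟩ := hedge i j hj h1 h2
    · constructor <;> omega
    · constructor <;> omega
  · intro i j i' j' hj hj' h1 h2 h1' h2' hX
    obtain ⟨a, ha, h3⟩ := hedge i j hj h1 h2
    obtain ⟨b, hb, h4⟩ := hedge i' j' hj' h1' h2'
    have hab : a = b := by omega
    subst hab
    have hcases : (g i j = g i' j' ∧ g i (j + 1) = g i' (j' + 1)) ∨
        (g i j = g i' (j' + 1) ∧ g i (j + 1) = g i' j') := by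
      rcases h3 with h3 | h3 <;> rcases h4 with h4 | h4
      · exact Or.inl ⟨hinj (Fin.ext (by omega)), hinj (Fin.ext (by omega))⟩
      · exact Or.inr ⟨hinj (Fin.ext (by omega)), hinj (Fin.ext (by omega))⟩
      · exact Or.inr ⟨hinj (Fin.ext (by omega)), hinj (Fin.ext (by omega))⟩
      · exact Or.inl ⟨hinj (Fin.ext (by omega)), hinj (Fin.ext (by omega))⟩
    rcases hcases with ⟨-, h6⟩ | ⟨h5, h6⟩
    · obtain ⟨h7, h8⟩ := h.inj (by omega) hj (by omega) hj' h6
      exact ⟨h7, by omega⟩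
    · have h7 := (h.eq_or_of_eq hj.le hj' h5).1
      have h8 := (h.eq_or_of_eq hj hj'.le h6).1
      omega

open Classical in
omit [Fintype V] in
/-- Lower bound for the size of a vertex set from lower bounds on the legs, one of them
together with the center. -/
lemma le_card (h : LegSystem F c m g) (T : Finset V) (w : ι → ℕ) (i₀ : ι)
    (h₀ : w i₀ ≤ (if g i₀ 0 ∈ T then 1 else 0) + #{j ∈ Icc 1 (m i₀) | g i₀ j ∈ T})
    (hw : ∀ i, i ≠ i₀ → w i ≤ #{j ∈ Icc 1 (m i) | g i j ∈ T}) : ∑ i, w i ≤ #T := by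
  rw [h.card_eq, ← add_sum_erase _ _ (mem_univ i₀), ← add_sum_erase _ _ (mem_univ i₀), ← add_assoc]
  refine add_le_add ?_ (sum_le_sum fun i hi => hw i (ne_of_mem_erase hi))
  rwa [h.zero] at h₀

lemma sum_add_ite [DecidableEq ι] (w : ι → ℕ) (i₀ : ι) :
    ∑ i, (w i + if i = i₀ then 1 else 0) = ∑ i, w i + 1 := by
  rw [sum_add_distrib]; simp

/-- A spider with a leg of odd length has no vertex cover by `∑ i, m i / 2` vertices. -/
lemma free_graphS_zero (h : LegSystem F c m g) {i₀ : ι} (hi₀ : Odd (m i₀)) (n : ℕ) :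
    F.Free (graphS n (∑ i, m i / 2) 0) := by
  classical
  refine h.free_graphS fun T X hT hX _ => ?_
  have hcov : ∀ i j, j < m i → g i j ∈ T ∨ g i (j + 1) ∈ T := by
    intro i j hj
    by_contra hcon
    push Not at hcon
    exact absurd (hX i j hj hcon.1 hcon.2).2 (Nat.not_lt_zero _)
  -- With the center, the odd leg has a perfect matching of `m i₀ / 2 + 1` edges; every other leg
  -- has `m i / 2` disjoint edges avoiding the center. Each of these edges meets `T`.
  have h1 := h.le_card T (fun i => m i / 2 + if i = i₀ then 1 else 0) i₀ ?_ ?_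
  · rw [sum_add_ite] at h1
    omega
  · rw [if_pos rfl]
    refine le_add_card_Icc_of_pairs (fun j => g i₀ j ∈ T) (by grind) fun s hs => ?_
    exact hcov i₀ (2 * s) (by grind)
  · intro i hi
    rw [if_neg hi, add_zero]
    refine le_card_Icc_of_pairs (fun j => g i j ∈ T) (a := m i % 2 + 1) (by omega) (by omega)
      fun s hs => ?_
    exact hcov i _ (by omega)

/-- A spider whose legs all have even length. -/
lemma free_graphS_one_even (h : LegSystem F c m g) [Nonempty ι] (hm : ∀ i, Even (m i)) (n : ℕ) :
    F.Free (graphS n (∑ i, m i / 2 - 1) 1) := by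
  classical
  refine h.free_graphS fun T X hT hX huniq => ?_
  have hpos : 1 ≤ ∑ i, m i / 2 := by
    have i₀ := Classical.arbitrary ι
    refine le_trans ?_ (single_le_sum (f := fun i => m i / 2) (fun i _ => Nat.zero_le _)
      (mem_univ i₀))
    have := h.pos i₀
    have := hm i₀
    grind
  obtain ⟨i₀, hi₀⟩ : ∃ i₀, ∀ i j, j < m i → g i j ∉ T → g i (j + 1) ∉ T →
      (i = i₀ ∧ ∀ j', j' < m i₀ → g i₀ j' ∉ T → g i₀ (j' + 1) ∉ T → j' = j) := by
    by_cases hex : ∃ i j, j < m i ∧ g i j ∉ T ∧ g i (j + 1) ∉ T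
    · obtain ⟨i₀, j₀, h1, h2, h3⟩ := hex
      refine ⟨i₀, fun i j hj a b => ?_⟩
      have e1 := (hX i j hj a b).2
      have e2 := (hX i₀ j₀ h1 h2 h3).2
      obtain ⟨rfl, rfl⟩ := huniq i j i₀ j₀ hj h1 a b h2 h3 (by omega)
      refine ⟨rfl, fun j' hj' a' b' => ?_⟩
      have e3 := (hX i j' hj' a' b').2
      exact (huniq i j' i j hj' hj a' b' a b (by omega)).2
    · push Not at hex
      exact ⟨Classical.arbitrary ι, fun i j hj a b => absurd (hex i j hj a) b⟩
  have h1 := h.le_card T (fun i => m i / 2) i₀ ?_ ?_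
  · omega
  -- The leg with its center has two edge-disjoint matchings of size `m i₀ / 2`, starting at
  -- position `0` or `1`. The single uncovered edge spoils at most one of them.
  · by_cases hA : ∀ s < m i₀ / 2, g i₀ (2 * s) ∈ T ∨ g i₀ (2 * s + 1) ∈ T
    · exact le_add_card_Icc_of_pairs (fun j => g i₀ j ∈ T) (by omega) hA
    · push Not at hA
      obtain ⟨s₀, hs₀, a, b⟩ := hA
      refine le_trans ?_ (Nat.le_add_left _ _)
      refine le_card_Icc_of_pairs (fun j => g i₀ j ∈ T) (a := 1) (by omega) (by omega)
        fun s hs => ?_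
      by_contra hcon
      push Not at hcon
      have := (hi₀ i₀ (2 * s₀) (by omega) a b).2 (1 + 2 * s) (by omega) hcon.1 hcon.2
      omega
  · intro i hi
    refine le_card_Icc_of_pairs (fun j => g i j ∈ T) (a := 1) (by omega)
      (by have := hm i; grind) fun s hs => ?_
    by_contra hcon
    push Not at hcon
    exact hi (hi₀ i (1 + 2 * s) (by omega) hcon.1 hcon.2).1

/-- A spider with at least two legs, all of odd length. -/
lemma free_graphS_one_odd (h : LegSystem F c m g) [Nontrivial ι] (hm : ∀ i, Odd (m i)) (n : ℕ) :
    F.Free (graphS n (∑ i, m i / 2) 1) := by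
  classical
  refine h.free_graphS fun T X hT hX huniq => ?_
  obtain ⟨i₀, hi₀⟩ : ∃ i₀, ∀ i j, j < m i → g i j ∉ T → g i (j + 1) ∉ T →
      (i ≠ i₀ ∧ ∀ j', j' < m i → g i j' ∉ T → g i (j' + 1) ∉ T → j' = j) := by
    by_cases hex : ∃ i j, j < m i ∧ g i j ∉ T ∧ g i (j + 1) ∉ T
    · obtain ⟨i₁, j₁, h1, h2, h3⟩ := hex
      -- The center is charged to a leg without the uncovered edge, so that the perfect matching of
      -- that leg is fully hit.
      obtain ⟨i₀, hi₀⟩ := exists_ne i₁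
      refine ⟨i₀, fun i j hj a b => ?_⟩
      have e1 := (hX i j hj a b).2
      have e2 := (hX i₁ j₁ h1 h2 h3).2
      obtain ⟨rfl, rfl⟩ := huniq i j i₁ j₁ hj h1 a b h2 h3 (by omega)
      refine ⟨hi₀.symm, fun j' hj' a' b' => ?_⟩
      have e3 := (hX i j' hj' a' b').2
      exact (huniq i j' i j hj' hj a' b' a b (by omega)).2
    · push Not at hex
      exact ⟨Classical.arbitrary ι, fun i j hj a b => absurd (hex i j hj a) b⟩
  have h1 := h.le_card T (fun i => m i / 2 + if i = i₀ then 1 else 0) i₀ ?_ ?_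
  · rw [sum_add_ite] at h1
    omega
  · rw [if_pos rfl]
    refine le_add_card_Icc_of_pairs (fun j => g i₀ j ∈ T) (by have := hm i₀; grind) fun s hs => ?_
    by_contra hcon
    push Not at hcon
    exact (hi₀ i₀ (2 * s) (by have := hm i₀; grind) hcon.1 hcon.2).1 rfl
  · intro i hi
    rw [if_neg hi, add_zero]
    by_cases hA : ∀ s < m i / 2, g i (1 + 2 * s) ∈ T ∨ g i (1 + 2 * s + 1) ∈ T
    · exact le_card_Icc_of_pairs (fun j => g i j ∈ T) (a := 1) (by omega) (by omega) hA
    · push Not at hA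
      obtain ⟨s₀, hs₀, a, b⟩ := hA
      refine le_card_Icc_of_pairs (fun j => g i j ∈ T) (a := 2) (by omega)
        (by have := hm i; grind) fun s hs => ?_
      by_contra hcon
      push Not at hcon
      have := (hi₀ i (1 + 2 * s₀) (by omega) a b).2 (2 + 2 * s) (by have := hm i; grind)
        hcon.1 hcon.2
      omega

/-- A spider all of whose legs have length one or three, with `p` smaller than the number of legs
or at least two legs of length one. -/
lemma free_graphS_short (h : LegSystem F c m g) (hm : ∀ i, m i = 1 ∨ m i = 3)
    [Nonempty ι] {p : ℕ}
    (hp : p < Fintype.card ι ∨ ∃ i i', i ≠ i' ∧ m i = 1 ∧ m i' = 1) (n : ℕ) :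
    F.Free (graphS n (∑ i, m i / 2) p) := by
  classical
  refine h.free_graphS fun T X hT hX huniq => ?_
  -- Consecutive uncovered edges would carry the same label. So each leg of length three contains a
  -- vertex of `T` off the center; the size bound then leaves exactly one per such leg and nothing
  -- elsewhere.
  have hcons : ∀ i j, j + 1 < m i → g i j ∉ T → g i (j + 1) ∉ T → g i (j + 2) ∉ T → False := by
    intro i j hj a b d
    have e1 := (hX i j (by omega) a b).1
    have := (huniq i j i (j + 1) (by omega) hj a b b d e1).2
    omega
  have hlow : ∀ i, m i / 2 ≤ #{j ∈ Icc 1 (m i) | g i j ∈ T} := by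
    intro i
    rcases hm i with hi | hi
    · rw [hi]; exact Nat.zero_le _
    · by_contra hcon
      have h0 : #{j ∈ Icc 1 (m i) | g i j ∈ T} = 0 := by omega
      rw [card_eq_zero, filter_eq_empty_iff] at h0
      exact hcons i 1 (by omega) (h0 (mem_Icc.2 ⟨by omega, by omega⟩))
        (h0 (mem_Icc.2 ⟨by omega, by omega⟩)) (h0 (mem_Icc.2 ⟨by omega, by omega⟩))
  have hcard := h.card_eq T
  have hsum := sum_le_sum (s := univ) fun i _ => hlow i
  have hcT : c ∉ T := by
    intro hc
    rw [if_pos hc] at hcard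
    omega
  have h0T : ∀ i, g i 0 ∉ T := fun i => by rwa [h.zero]
  rw [if_neg hcT, zero_add] at hcard
  have heq : ∀ i, #{j ∈ Icc 1 (m i) | g i j ∈ T} = m i / 2 := by
    have := (sum_eq_sum_iff_of_le (s := univ) fun i _ => hlow i).1 (by omega)
    exact fun i => (this i (mem_univ i)).symm
  have hunique : ∀ i, m i = 3 → ∀ j j', j ∈ Icc 1 (m i) → j' ∈ Icc 1 (m i) → g i j ∈ T →
      g i j' ∈ T → j = j' := by
    intro i hi j j' hj hj' hT1 hT2
    have h1 := heq i
    rw [hi] at h1 hj hj'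
    exact card_le_one.1 h1.le j (mem_filter.2 ⟨hj, hT1⟩) j' (mem_filter.2 ⟨hj', hT2⟩)
  have hone : ∀ i, m i = 1 → g i 1 ∉ T := by
    intro i hi hT1
    have h1 := heq i
    rw [hi, show 1 / 2 = 0 from rfl, card_eq_zero, filter_eq_empty_iff] at h1
    exact h1 (mem_Icc.2 ⟨le_rfl, le_rfl⟩) hT1
  have hex : ∀ i, ∃ j, j < m i ∧ g i j ∉ T ∧ g i (j + 1) ∉ T := by
    intro i
    rcases hm i with hi | hi
    · exact ⟨0, by omega, h0T i, hone i hi⟩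
    · by_cases h1 : g i 1 ∈ T
      · refine ⟨2, by omega, fun h2 => ?_, fun h2 => ?_⟩
        · have := hunique i hi 1 2 (mem_Icc.2 (by omega)) (mem_Icc.2 (by omega)) h1 h2
          omega
        · have := hunique i hi 1 3 (mem_Icc.2 (by omega)) (mem_Icc.2 (by omega)) h1 h2
          omega
      · exact ⟨0, by omega, h0T i, h1⟩
  rcases hp with hp | ⟨i, i', hii, hi, hi'⟩
  · choose J hJ a b using hex
    have hinj : Function.Injective fun i => (⟨X (g i (J i)), (hX i _ (hJ i) (a i) (b i)).2⟩ :
        Fin p) := by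
      intro i i' hii
      exact (huniq i _ i' _ (hJ i) (hJ i') (a i) (b i) (a i') (b i') (congrArg Fin.val hii)).1
    have := Fintype.card_le_of_injective _ hinj
    rw [Fintype.card_fin] at this
    omega
  · refine hii (huniq i 0 i' 0 (by omega) (by omega) (h0T i) (hone i hi) (h0T i') (hone i' hi')
      (by rw [h.zero, h.zero])).1

end LegSystem

lemma exists_forall_imp {A : Prop} {P : ℕ → Prop} (h : A → ∃ N, ∀ n, N ≤ n → P n) :
    ∃ N, ∀ n, N ≤ n → A → P n := by
  by_cases hA : A
  · obtain ⟨N, hN⟩ := h hA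
    exact ⟨N, fun n hn _ => hN n hn⟩
  · exact ⟨0, fun n _ h' => absurd h' hA⟩

/-! ### The five cases for a leg system. -/

section Cases

variable {V ι : Type*} [Fintype V] [Fintype ι] {F : SimpleGraph V} {c : V} {m : ι → ℕ}
  {g : ι → ℕ → V}

namespace LegSystem

lemma half_sum_le_card (h : LegSystem F c m g) : ∑ i, m i / 2 ≤ Fintype.card V := by
  rw [h.card_vertices]
  have : ∑ i, m i / 2 ≤ ∑ i, m i := sum_le_sum fun i _ => Nat.div_le_self _ _
  omega

lemma one_le_half_sum {i₀ : ι} (hi₀ : 2 ≤ m i₀) : 1 ≤ ∑ i, m i / 2 := by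
  refine le_trans ?_ (single_le_sum (f := fun i => m i / 2) (fun i _ => Nat.zero_le _)
    (mem_univ i₀))
  change 1 ≤ m i₀ / 2
  omega

/-- Dropping the leaf of an even leg from the even cover leaves a single edge, so not even one edge
is allowed outside the dominating set. -/
lemma SPEX_of_even_of_odd (h : LegSystem F c m g) {i₀ i₁ : ι} (h₀ : Even (m i₀))
    (h₁ : Odd (m i₁)) :
    ∃ N, ∀ n, N ≤ n → SPEX n F = isoClassS n (∑ i, m i / 2) 0 := by
  have : Nonempty ι := ⟨i₀⟩
  obtain ⟨d, par, hpar⟩ := h.exists_parent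
  have hm : 2 ≤ m i₀ := by have := h.pos i₀; grind
  exact SPEX_eq_isoClassS F d par hpar _ (one_le_half_sum hm) h.half_sum_le_card h.splits_even
    (h.splits_path_even hm) (fun _ => 0)
    (fun _ => Or.inr (h.splits_matching_even (fun _ : Fin 1 => i₀)
      (fun a b _ => Subsingleton.elim (α := Fin 1) a b) fun _ => h₀))
    (h.free_graphS_zero h₁)

/-- The odd positions form a cover with one vertex fewer than the even ones, which lowers `k` by
one. Dropping the leaves of two legs from the even cover leaves two edges. -/
lemma SPEX_of_forall_even (h : LegSystem F c m g) [Nontrivial ι] (hm : ∀ i, Even (m i)) :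
    ∃ N, ∀ n, N ≤ n → SPEX n F = isoClassS n (∑ i, m i / 2 - 1) 1 := by
  classical
  obtain ⟨d, par, hpar⟩ := h.exists_parent
  obtain ⟨i₀, i₁, hne⟩ := exists_pair_ne ι
  have hm2 : ∀ i, 2 ≤ m i := fun i => by have := h.pos i; have := hm i; grind
  have hsum : ∑ i, (m i + 1) / 2 = ∑ i, m i / 2 := sum_congr rfl fun i _ => by
    have := hm i; grind
  have htwo : 2 ≤ ∑ i, m i / 2 := by
    calc 2 ≤ ∑ i ∈ {i₀, i₁}, m i / 2 := by
          rw [sum_pair hne]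
          have := hm2 i₀
          have := hm2 i₁
          omega
      _ ≤ _ := sum_le_sum_of_subset (subset_univ _)
  have hle := h.half_sum_le_card
  have hcov := h.splits_odd
  have hpath := h.splits_path_odd (hm2 i₀)
  rw [hsum] at hcov hpath
  refine SPEX_eq_isoClassS F d par hpar _ (by omega) (by omega) ?_ hpath (fun _ => 1)
    (fun _ => Or.inr ?_) (h.free_graphS_one_even hm)
  · rwa [Nat.sub_add_cancel (by omega)]
  · refine h.splits_matching_even ![i₀, i₁] ?_ fun _ => hm _
    intro a b hab
    fin_cases a <;> fin_cases b <;> first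
      | rfl
      | exact absurd hab hne
      | exact absurd hab hne.symm

lemma SPEX_of_forall_odd (h : LegSystem F c m g) [Nontrivial ι] (hm : ∀ i, Odd (m i)) {i₀ : ι}
    (hi₀ : 5 ≤ m i₀) :
    ∃ N, ∀ n, N ≤ n → SPEX n F = isoClassS n (∑ i, m i / 2) 1 := by
  obtain ⟨d, par, hpar⟩ := h.exists_parent
  exact SPEX_eq_isoClassS F d par hpar _ (one_le_half_sum (i₀ := i₀) (by omega))
    h.half_sum_le_card h.splits_even (h.splits_path_even (i₀ := i₀) (by omega)) (fun _ => 1)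
    (fun _ => Or.inr (h.splits_matching_two hi₀ (hm i₀))) (h.free_graphS_one_odd hm)

lemma SPEX_of_short (h : LegSystem F c m g) (hm : ∀ i, m i = 1 ∨ m i = 3) {i₀ : ι}
    (hi₀ : m i₀ = 3) (hone : ∀ i i', m i = 1 → m i' = 1 → i = i') :
    ∃ N, ∀ n, N ≤ n → SPEX n F = isoClassS n (∑ i, m i / 2) (Fintype.card ι - 1) := by
  have : Nonempty ι := ⟨i₀⟩
  obtain ⟨d, par, hpar⟩ := h.exists_parent
  have hpos : 0 < Fintype.card ι := Fintype.card_pos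
  refine SPEX_eq_isoClassS F d par hpar _ (one_le_half_sum (i₀ := i₀) (by omega))
    h.half_sum_le_card h.splits_even (h.splits_path_even (i₀ := i₀) (by omega))
    (fun _ => Fintype.card ι - 1) (fun _ => Or.inr ?_)
    (h.free_graphS_short hm (Or.inl (by omega)))
  rw [Nat.sub_add_cancel hpos]
  exact h.splits_matching_legs hm hone

/-- Two legs of length one leave edges that share the center, so what remains of `F` is never a
matching and the added matching may be as large as fits. -/
lemma SPEX_of_short_of_two (h : LegSystem F c m g) (hm : ∀ i, m i = 1 ∨ m i = 3) {i₀ : ι}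
    (hi₀ : m i₀ = 3) (htwo : ∃ i i', i ≠ i' ∧ m i = 1 ∧ m i' = 1) :
    ∃ N, ∀ n, N ≤ n →
      SPEX n F = isoClassS n (∑ i, m i / 2) ((n - ∑ i, m i / 2) / 2) := by
  have : Nonempty ι := ⟨i₀⟩
  obtain ⟨d, par, hpar⟩ := h.exists_parent
  exact SPEX_eq_isoClassS F d par hpar _ (one_le_half_sum (i₀ := i₀) (by omega))
    h.half_sum_le_card h.splits_even (h.splits_path_even (i₀ := i₀) (by omega))
    (fun n => (n - ∑ i, m i / 2) / 2) (fun _ => Or.inl le_rfl)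
    (fun n => h.free_graphS_short hm (Or.inr htwo) n)

end LegSystem

end Cases

end SpectralSpider

/-! ### Translating leg counts into the five cases. -/

open SpectralSpider in
theorem theorem1p6 {V : Type*} [Fintype V] (F : SimpleGraph V) [DecidableRel F.Adj]
    (c : V) (r₁ r₂ r₃ r s ℓ : ℕ) (hr : r = r₁ + r₂ + r₃) (hℓ : 4 ≤ ℓ)
    (hF : SpectralSpider.IsSpider F) (hcard : Fintype.card V = ℓ)
    (hc : SpectralSpider.IsCenter F c)
    (hr₁ : SpectralSpider.legCount F c (fun k => Odd k ∧ 5 ≤ k) = r₁)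
    (hr₂ : SpectralSpider.legCount F c (fun k => k = 3) = r₂)
    (hr₃ : SpectralSpider.legCount F c (fun k => k = 1) = r₃)
    (hs : SpectralSpider.legCount F c (fun k => Even k) = s) :
    ∃ N : ℕ, ∀ n : ℕ, N ≤ n →
      (1 ≤ s → 1 ≤ r →
        SpectralSpider.SPEX n F = SpectralSpider.isoClassS n ((ℓ - r - 1) / 2) 0) ∧
      (1 ≤ s → r = 0 →
        SpectralSpider.SPEX n F = SpectralSpider.isoClassS n ((ℓ - 3) / 2) 1) ∧
      (s = 0 → 1 ≤ r₁ →
        SpectralSpider.SPEX n F = SpectralSpider.isoClassS n ((ℓ - r - 1) / 2) 1) ∧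
      (s = 0 → r₁ = 0 → 1 ≤ r₂ → (r₃ = 0 ∨ r₃ = 1) →
        SpectralSpider.SPEX n F = SpectralSpider.isoClassS n ((ℓ - r - 1) / 2) (r - 1)) ∧
      (s = 0 → r₁ = 0 → 1 ≤ r₂ → 2 ≤ r₃ →
        SpectralSpider.SPEX n F =
          SpectralSpider.isoClassS n ((ℓ - r - 1) / 2) ((2 * n + r + 1 - ℓ) / 4)) := by
  classical
  obtain ⟨m, g, h, hι, hleg⟩ := exists_legSystem hF hc
  have : Nontrivial {v : V // F.degree v = 1} := Fintype.one_lt_card_iff_nontrivial.1 hι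
  have hcount : ∀ (P : ℕ → Prop) [DecidablePred P],
      legCount F c P = (Finset.univ.filter fun i => P (m i)).card := by
    intro P _
    rw [hleg, Set.ncard_eq_toFinset_card']
    congr 1
    ext i
    simp
  rw [hcount] at hr₁ hr₂ hr₃ hs
  -- The three counts together range over all legs of odd length.
  have hrsum : r = ∑ i, m i % 2 := by
    rw [hr, ← hr₁, ← hr₂, ← hr₃, Finset.card_filter, Finset.card_filter, Finset.card_filter,
      ← Finset.sum_add_distrib, ← Finset.sum_add_distrib]
    refine Finset.sum_congr rfl fun i _ => ?_
    have := h.pos i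
    grind
  have hsize : ℓ = 1 + 2 * (∑ i, m i / 2) + r := by
    rw [← hcard, h.card_vertices, hrsum, Finset.mul_sum, add_assoc, ← Finset.sum_add_distrib]
    congr 1
    exact Finset.sum_congr rfl fun i _ => (Nat.div_add_mod _ _).symm
  have hk : (ℓ - r - 1) / 2 = ∑ i, m i / 2 := by omega
  have hall : s = 0 → ∀ i, Odd (m i) := by
    intro h0 i
    rw [← hs, Finset.card_eq_zero, Finset.filter_eq_empty_iff] at h0
    exact Nat.not_even_iff_odd.1 (h0 (Finset.mem_univ i))
  have hshort : s = 0 → r₁ = 0 → ∀ i, m i = 1 ∨ m i = 3 := by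
    intro h0 h1 i
    have hodd := hall h0 i
    rw [← hr₁, Finset.card_eq_zero, Finset.filter_eq_empty_iff] at h1
    have := h1 (Finset.mem_univ i)
    have := h.pos i
    grind
  have hthree : 1 ≤ r₂ → ∃ i, m i = 3 := by
    intro h1
    rw [← hr₂] at h1
    obtain ⟨i, hi⟩ := Finset.card_pos.1 h1
    exact ⟨i, (Finset.mem_filter.1 hi).2⟩
  have hcardι : s = 0 → Fintype.card {v : V // F.degree v = 1} = r := by
    intro h0
    rw [hrsum, ← Finset.card_univ, Finset.card_eq_sum_ones]
    exact Finset.sum_congr rfl fun i _ => (Nat.odd_iff.1 (hall h0 i)).symm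
  obtain ⟨N₁, hN₁⟩ : ∃ N, ∀ n, N ≤ n → (1 ≤ s ∧ 1 ≤ r) →
      SPEX n F = isoClassS n ((ℓ - r - 1) / 2) 0 := by
    refine exists_forall_imp fun ⟨h1, h2⟩ => ?_
    rw [← hs] at h1
    obtain ⟨i₀, hi₀⟩ := Finset.card_pos.1 h1
    obtain ⟨i₁, hi₁⟩ : ∃ i, Odd (m i) := by
      by_contra hcon
      push Not at hcon
      have : r = 0 := by
        rw [hrsum]
        exact Finset.sum_eq_zero fun i _ => Nat.even_iff.1 (by simpa using hcon i)
      omega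
    rw [hk]
    exact h.SPEX_of_even_of_odd (Finset.mem_filter.1 hi₀).2 hi₁
  obtain ⟨N₂, hN₂⟩ : ∃ N, ∀ n, N ≤ n → (1 ≤ s ∧ r = 0) →
      SPEX n F = isoClassS n ((ℓ - 3) / 2) 1 := by
    refine exists_forall_imp fun ⟨h1, h2⟩ => ?_
    have heven : ∀ i, Even (m i) := fun i => by
      rw [hrsum, Finset.sum_eq_zero_iff] at h2
      exact Nat.even_iff.2 (h2 i (Finset.mem_univ i))
    rw [show (ℓ - 3) / 2 = ∑ i, m i / 2 - 1 by omega]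
    exact h.SPEX_of_forall_even heven
  obtain ⟨N₃, hN₃⟩ : ∃ N, ∀ n, N ≤ n → (s = 0 ∧ 1 ≤ r₁) →
      SPEX n F = isoClassS n ((ℓ - r - 1) / 2) 1 := by
    refine exists_forall_imp fun ⟨h1, h2⟩ => ?_
    rw [← hr₁] at h2
    obtain ⟨i₀, hi₀⟩ := Finset.card_pos.1 h2
    rw [hk]
    exact h.SPEX_of_forall_odd (hall h1) (Finset.mem_filter.1 hi₀).2.2
  obtain ⟨N₄, hN₄⟩ : ∃ N, ∀ n, N ≤ n → (s = 0 ∧ r₁ = 0 ∧ 1 ≤ r₂ ∧ (r₃ = 0 ∨ r₃ = 1)) →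
      SPEX n F = isoClassS n ((ℓ - r - 1) / 2) (r - 1) := by
    refine exists_forall_imp fun ⟨h1, h2, h3, h4⟩ => ?_
    obtain ⟨i₀, hi₀⟩ := hthree h3
    rw [hk, ← hcardι h1]
    refine h.SPEX_of_short (hshort h1 h2) hi₀ fun i i' hi hi' => ?_
    have hle : r₃ ≤ 1 := by omega
    rw [← hr₃] at hle
    exact Finset.card_le_one.1 hle i (by simpa using hi) i' (by simpa using hi')
  obtain ⟨N₅, hN₅⟩ : ∃ N, ∀ n, N ≤ n → (s = 0 ∧ r₁ = 0 ∧ 1 ≤ r₂ ∧ 2 ≤ r₃) →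
      SPEX n F = isoClassS n ((ℓ - r - 1) / 2) ((2 * n + r + 1 - ℓ) / 4) := by
    refine exists_forall_imp fun ⟨h1, h2, h3, h4⟩ => ?_
    obtain ⟨i₀, hi₀⟩ := hthree h3
    rw [← hr₃] at h4
    obtain ⟨i, hi, i', hi', hne⟩ := Finset.one_lt_card.1 h4
    obtain ⟨N, hN⟩ := h.SPEX_of_short_of_two (hshort h1 h2) hi₀
      ⟨i, i', hne, (Finset.mem_filter.1 hi).2, (Finset.mem_filter.1 hi').2⟩
    refine ⟨N, fun n hn => ?_⟩
    -- By `hsize`, `ℓ - r - 1` is twice the half sum, so this is the size of a largest matching on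
    -- the remaining vertices.
    rw [hk, show (2 * n + r + 1 - ℓ) / 4 = (n - ∑ i, m i / 2) / 2 by omega]
    exact hN n hn
  exact ⟨N₁ + N₂ + N₃ + N₄ + N₅, fun n hn =>
    ⟨fun a b => hN₁ n (by omega) ⟨a, b⟩, fun a b => hN₂ n (by omega) ⟨a, b⟩,
      fun a b => hN₃ n (by omega) ⟨a, b⟩, fun a b d e => hN₄ n (by omega) ⟨a, b, d, e⟩,
      fun a b d e => hN₅ n (by omega) ⟨a, b, d, e⟩⟩⟩
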